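/- **Theorem 5.3 (Convergence of the optimal control).** Let $Q,Q_f\in\mathbb R^{n\times n}$ be symmetric positive semidefinite, $R\in\mathbb R^{m\times m}$ symmetric positive definite (assumption (SH)), $B\in\mathbb R^{n\times m}$, let $\mathcal A\subset\mathbb R^{n\times n}$ be compact, and fix $T$, $s\in[0,T]$ and $x_0\in\mathbb R^n$. For a Borel probability measure $\pi$ on $\mathcal A$ let Problem $B_\pi$ be: minimize $$J_{s,\pi}[u]=\int_{\mathcal A}\Big[\tfrac12\int_s^T\big(x_A(t)^TQx_A(t)+u(t)^TRu(t)\big)\,dt+\tfrac12\,x_A(T)^TQ_fx_A(T)\Big]\,d\pi(A)\in[0,\infty]$$ over all Lebesgue measurable $u:[s,T]\to\mathbb R^m$ for which the Cauchy problems $\dot x_A(t)=Ax_A(t)+Bu(t)$ for a.e. $t\in[s,T]$, $x_A(s)=x_0$, have absolutely continuous solutions $x_A:[s,T]\to\mathbb R^n$ for all $A\in\mathcal A$. A minimizing $u$ is called an optimal control of $B_\pi$. Let $\pi^N$ $(N\in\mathbb N)$ and $\pi^\infty$ be Borel probability measures on $\mathcal A$ such that $\pi^N\to\pi^\infty$ weakly-$*$,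 i.e. $\int_{\mathcal A} f\,d\pi^N\to\int_{\mathcal A} f\,d\pi^\infty$ for every bounded continuous $f:\mathcal A\to\mathbb R$. Then each of the problems $B_{\pi^N}$ $(N\in\mathbb N)$ and $B_{\pi^\infty}$ has an optimal control that is continuous on $[s,T]$, every optimal control of the same problem agrees with it almost everywhere on $[s,T]$, and these continuous optimal controls $\bar u^N$, $\bar u^\infty$ can be chosen such that $\bar u^N\to\bar u^\infty$ uniformly on $[s,T]$. (If $s<T$, the continuous optimal control of each problem is unique, so there is no choice.) Moreover, if $\pi^\infty=\delta_{\hat A}$ for some $\hat A\in\mathcal A$, then the limit $\bar u^\infty$ is the optimal control, unique up to equality almost everywhere, of the LQR problem with matrix $\hat A$: minimize $\tfrac12\int_s^T(x^TQx+u^TRu)\,dt+\tfrac12 x(T)^TQ_fx(T)$ over all Lebesgue measurable $u:[s,T]\to\mathbb R^m$ and absolutely continuous $x$ with $\dot x=\hat Ax+Bu$ a.e. on $[s,T]$, $x(s)=x_0$. -/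

import Mathlib

open MeasureTheory Set Filter
open scoped Topology Matrix ENNReal

namespace AveragedLQ

/-- Spaces of real matrices carry the Borel σ-algebra of their usual topology. -/
instance instMeasurableSpaceMatrix {k l : ℕ} : MeasurableSpace (Matrix (Fin k) (Fin l) ℝ) :=
  borel _

instance instBorelSpaceMatrix {k l : ℕ} : BorelSpace (Matrix (Fin k) (Fin l) ℝ) := ⟨rfl⟩

/-- `x` solves `x' = A x + B u` on `[s, T]`, `x(s) = x₀`, in the sense of Carathéodory: the right-hand
side is Lebesgue integrable on `[s, T]`, and `x` is its integral (so `x` is absolutely continuous on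
`[s, T]` and solves the equation almost everywhere). -/
def IsTrajectory {n m : ℕ} (A : Matrix (Fin n) (Fin n) ℝ) (B : Matrix (Fin n) (Fin m) ℝ)
    (s T : ℝ) (x₀ : Fin n → ℝ) (u : ℝ → Fin m → ℝ) (x : ℝ → Fin n → ℝ) : Prop :=
  IntervalIntegrable (fun t => A *ᵥ x t + B *ᵥ u t) volume s T ∧
    ∀ t ∈ Icc s T, x t = x₀ + ∫ τ in s..t, (A *ᵥ x τ + B *ᵥ u τ)

/-- The quadratic cost `½ ∫_s^T (xᵀ Q x + uᵀ R u) dt + ½ x(T)ᵀ Q_f x(T)` of a pair `(x, u)`. All terms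
are nonnegative for positive semidefinite `Q`, `Q_f`, `R`; the value lies in `[0, ∞]`, and it is `∞`
when the integral diverges. -/
noncomputable def cost {n m : ℕ} (Q Qf : Matrix (Fin n) (Fin n) ℝ) (R : Matrix (Fin m) (Fin m) ℝ)
    (s T : ℝ) (x : ℝ → Fin n → ℝ) (u : ℝ → Fin m → ℝ) : ℝ≥0∞ :=
  2⁻¹ * (∫⁻ t in Icc s T, ENNReal.ofReal (x t ⬝ᵥ (Q *ᵥ x t) + u t ⬝ᵥ (R *ᵥ u t)))
    + 2⁻¹ * ENNReal.ofReal (x T ⬝ᵥ (Qf *ᵥ x T))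

/-- Controls: Lebesgue measurable functions on `[s, T]`. The values outside `[s, T]` are irrelevant. -/
def IsControl {m : ℕ} (s T : ℝ) (u : ℝ → Fin m → ℝ) : Prop :=
  AEMeasurable u (volume.restrict (Icc s T))

/-! ### The LQR problem with a known matrix -/

/-- Admissible processes `(x, u)` of the LQR problem with matrix `A`. -/
def IsAdmissibleLQR {n m : ℕ} (A : Matrix (Fin n) (Fin n) ℝ) (B : Matrix (Fin n) (Fin m) ℝ)
    (s T : ℝ) (x₀ : Fin n → ℝ) (x : ℝ → Fin n → ℝ) (u : ℝ → Fin m → ℝ) : Prop :=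
  IsControl s T u ∧ IsTrajectory A B s T x₀ u x

/-- `u` is an optimal control of the LQR problem with matrix `A`. -/
def IsOptimalLQR {n m : ℕ} (A : Matrix (Fin n) (Fin n) ℝ) (B : Matrix (Fin n) (Fin m) ℝ)
    (Q Qf : Matrix (Fin n) (Fin n) ℝ) (R : Matrix (Fin m) (Fin m) ℝ)
    (s T : ℝ) (x₀ : Fin n → ℝ) (u : ℝ → Fin m → ℝ) : Prop :=
  ∃ x, IsAdmissibleLQR A B s T x₀ x u ∧
    ∀ y v, IsAdmissibleLQR A B s T x₀ y v → cost Q Qf R s T x u ≤ cost Q Qf R s T y v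

/-! ### The averaged LQ problem -/

/-- Admissible processes `{(x_A, u) : A ∈ 𝒜}` of the averaged problem: one control for all `A`. -/
def IsAdmissibleAvg {n m : ℕ} (𝒜 : Set (Matrix (Fin n) (Fin n) ℝ)) (B : Matrix (Fin n) (Fin m) ℝ)
    (s T : ℝ) (x₀ : Fin n → ℝ) (x : 𝒜 → ℝ → Fin n → ℝ) (u : ℝ → Fin m → ℝ) : Prop :=
  IsControl s T u ∧ ∀ A : 𝒜, IsTrajectory (A : Matrix (Fin n) (Fin n) ℝ) B s T x₀ u (x A)

/-- The averaged cost, that is the expectation under `π` of the cost of `(x_A, u)`. -/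
noncomputable def avgCost {n m : ℕ} {𝒜 : Set (Matrix (Fin n) (Fin n) ℝ)}
    (Q Qf : Matrix (Fin n) (Fin n) ℝ) (R : Matrix (Fin m) (Fin m) ℝ) (s T : ℝ)
    (π : ProbabilityMeasure 𝒜) (x : 𝒜 → ℝ → Fin n → ℝ) (u : ℝ → Fin m → ℝ) : ℝ≥0∞ :=
  ∫⁻ A, cost Q Qf R s T (x A) u ∂(π : Measure 𝒜)

/-- `u` is an optimal control of the averaged problem with distribution `π`. -/
def IsOptimalAvg {n m : ℕ} {𝒜 : Set (Matrix (Fin n) (Fin n) ℝ)} (B : Matrix (Fin n) (Fin m) ℝ)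
    (Q Qf : Matrix (Fin n) (Fin n) ℝ) (R : Matrix (Fin m) (Fin m) ℝ)
    (s T : ℝ) (x₀ : Fin n → ℝ) (π : ProbabilityMeasure 𝒜) (u : ℝ → Fin m → ℝ) : Prop :=
  ∃ x, IsAdmissibleAvg 𝒜 B s T x₀ x u ∧
    ∀ y v, IsAdmissibleAvg 𝒜 B s T x₀ y v →
      avgCost Q Qf R s T π x u ≤ avgCost Q Qf R s T π y v

end AveragedLQ

/-! For a fixed matrix `A` the state is affine in the control, so the cost is a convex quadratic
functional. Its derivative at a continuous `u` in direction `w` is `∫ (R u + Bᵀ p_A) · w`, with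
`p_A` the costate. After averaging, stationarity reads `R u + ∫ Bᵀ p_A dπ = 0`. Since `Bᵀ p_A = M_A
(x₀ + ∫_s^t B u)` for a bounded operator `M_A` on continuous paths (`responseOp`), this is a linear
equation with operator `F_π u = R u + M_π (∫_s^t B u)`, where `M_π = ∫ M_A dπ`, and right-hand side
`-M_π x₀`.

`F_π` is invertible on continuous paths: the adjoint identity `integral_costate_dotProduct` makes
the second summand monotone, `R` is coercive, and the resulting a priori bound feeds the method of
continuity (`isUnit_feedbackOp`). Hence there is a continuous stationary control, `optControl`.

The second-order expansion `realCost_expansion` is exact. At a stationary control its linear term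
averages to zero and the remainder is at least `½ ∫ wᵀ R w`, which gives optimality and almost
everywhere uniqueness (`avgCost_stationary_le`).

For convergence, `A ↦ M_A` is continuous in operator norm, so weak-* convergence of the measures
yields operator-norm convergence of `M_π`, then of `F_π` and of its inverse; the controls converge
in the supremum norm (`tendsto_optControl`). For a Dirac measure at `A`, `M_π = M_A`, and
stationarity is that of the single LQR problem. -/

namespace AveragedLQ

/-! ### Vector-valued weak convergence and two invertibility criteria -/

/-- Weak convergence of probability measures on a compact space passes to integrals of continuous
functions with values in a Banach space. -/
theorem tendsto_integral_of_continuous {X F : Type*} [TopologicalSpace X] [CompactSpace X]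
    [T2Space X] [SecondCountableTopology X] [MeasurableSpace X] [BorelSpace X]
    [NormedAddCommGroup F] [NormedSpace ℝ F] [CompleteSpace F]
    {π : ℕ → ProbabilityMeasure X} {πinf : ProbabilityMeasure X}
    (hπ : Tendsto π atTop (𝓝 πinf)) {f : X → F} (hf : Continuous f) :
    Tendsto (fun N => ∫ a, f a ∂(π N : Measure X)) atTop (𝓝 (∫ a, f a ∂(πinf : Measure X))) := by
  have hint : ∀ (μ : ProbabilityMeasure X) {G : Type _} [NormedAddCommGroup G] [NormedSpace ℝ G]
      {g : X → G}, Continuous g → Integrable g (μ : Measure X) := fun μ G _ _ g hg =>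
    hg.integrable_of_hasCompactSupport (HasCompactSupport.of_compactSpace g)
  -- By compactness and a partition of unity, `f` is uniformly close to a finite sum of scalar
  -- functions times fixed vectors, and scalar weak convergence handles such sums.
  have key : ∀ ε > 0, ∃ g : X → F, Continuous g ∧ (∀ a, ‖f a - g a‖ ≤ ε) ∧
      Tendsto (fun N => ∫ a, g a ∂(π N : Measure X)) atTop
        (𝓝 (∫ a, g a ∂(πinf : Measure X))) := by
    intro ε hε
    have hU : ∀ a, IsOpen (f ⁻¹' Metric.ball (f a) ε) := fun a =>
      Metric.isOpen_ball.preimage hf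
    obtain ⟨t, ht⟩ := isCompact_univ.elim_finite_subcover
      (fun a => f ⁻¹' Metric.ball (f a) ε) hU
      (fun a _ => mem_iUnion.2 ⟨a, by simpa using hε⟩)
    obtain ⟨ρ, hρ⟩ := PartitionOfUnity.exists_isSubordinate isClosed_univ
      (fun i : t => f ⁻¹' Metric.ball (f i) ε) (fun i => hU i)
      (fun a ha => by
        obtain ⟨i, hi, hai⟩ := mem_iUnion₂.1 (ht ha)
        exact mem_iUnion.2 ⟨⟨i, hi⟩, hai⟩)
    refine ⟨fun a => ∑ i : t, ρ i a • f i, by fun_prop, fun a => ?_, ?_⟩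
    · have hsum : ∑ i : t, ρ i a = 1 := by
        rw [← finsum_eq_sum_of_fintype]; exact ρ.sum_eq_one (mem_univ a)
      have : f a - ∑ i : t, ρ i a • f i = ∑ i : t, ρ i a • (f a - f i) := by
        simp_rw [smul_sub, Finset.sum_sub_distrib, ← Finset.sum_smul, hsum, one_smul]
      rw [this]
      calc _ ≤ ∑ i : t, ρ i a * ε := by
            refine norm_sum_le_of_le _ fun i _ => ?_
            rw [norm_smul, Real.norm_of_nonneg (ρ.nonneg i a)]
            rcases eq_or_ne (ρ i a) 0 with h0 | h0
            · simp [h0]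
            · have := hρ i (subset_tsupport _ (Function.mem_support.2 h0))
              refine mul_le_mul_of_nonneg_left ?_ (ρ.nonneg i a)
              rw [← dist_eq_norm]
              exact (Metric.mem_ball.1 this).le
        _ = ε := by rw [← Finset.sum_mul, hsum, one_mul]
    · have hg : ∀ μ : ProbabilityMeasure X, ∫ a, ∑ i : t, ρ i a • f i ∂(μ : Measure X)
          = ∑ i : t, (∫ a, ρ i a ∂(μ : Measure X)) • f i := fun μ => by
        rw [integral_finsetSum _ fun i _ => hint μ (by fun_prop)]
        simp_rw [integral_smul_const]
      simp_rw [hg]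
      refine tendsto_finsetSum _ fun i _ => Tendsto.smul_const ?_ _
      exact ProbabilityMeasure.tendsto_iff_forall_integral_tendsto.1 hπ
        (BoundedContinuousFunction.mkOfCompact (ρ i))
  rw [Metric.tendsto_nhds]
  intro ε hε
  obtain ⟨g, hgc, hfg, hg⟩ := key (ε / 3) (by positivity)
  have hclose : ∀ μ : ProbabilityMeasure X,
      ‖∫ a, f a ∂(μ : Measure X) - ∫ a, g a ∂(μ : Measure X)‖ ≤ ε / 3 := fun μ => by
    rw [← integral_sub (hint μ hf) (hint μ hgc)]
    simpa using norm_integral_le_of_norm_le_const (μ := (μ : Measure X)) (ae_of_all _ hfg)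
  filter_upwards [Metric.tendsto_nhds.1 hg (ε / 3) (by positivity)] with N hN
  have h1 := hclose (π N)
  have h2 := hclose πinf
  rw [← dist_eq_norm] at h1 h2
  rw [dist_comm] at h2
  calc _ ≤ _ + _ + _ := dist_triangle4 _ _ _ _
    _ < ε := by linarith

/-- The method of continuity: if `a` is a unit and the right inverses of `a + c • k`, `c ∈ [0, 1]`,
are uniformly bounded, then `a + k` is a unit. -/
theorem isUnit_add_of_forall_norm_le {𝓡 : Type*} [NormedRing 𝓡] [NormedAlgebra ℝ 𝓡]
    [CompleteSpace 𝓡] {a k : 𝓡} (ha : IsUnit a) {C : ℝ}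
    (h : ∀ c ∈ Icc (0 : ℝ) 1, ∀ b, (a + c • k) * b = 1 → ‖b‖ ≤ C) : IsUnit (a + k) := by
  nontriviality 𝓡
  -- The segment from `a` to `a + k` is cut into `N` equal steps. As `N > ‖k‖ * C`, each step is
  -- shorter than the reciprocal of the norm of the inverse already reached, so the next point is
  -- again a unit.
  obtain ⟨N, hN⟩ := exists_nat_gt (max 0 (‖k‖ * C))
  have hN0 : (0 : ℝ) < N := (le_max_left _ _).trans_lt hN
  have step : ∀ j : ℕ, j ≤ N → IsUnit (a + ((j : ℝ) / N) • k) := by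
    intro j
    induction j with
    | zero => intro _; simpa using ha
    | succ j ih =>
      intro hj
      obtain ⟨x, hx⟩ := ih (by omega)
      have hb : ‖(↑x⁻¹ : 𝓡)‖ ≤ C := by
        refine h ((j : ℝ) / N) ⟨by positivity, ?_⟩ _ (by rw [← hx]; simp)
        rw [div_le_one hN0]
        exact_mod_cast (by omega : j ≤ N)
      have hpos : 0 < ‖(↑x⁻¹ : 𝓡)‖ := Units.norm_pos x⁻¹
      refine (Units.ofNearby x _ ?_).isUnit
      have : a + (((j + 1 : ℕ) : ℝ) / N) • k - x = (1 / N : ℝ) • k := by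
        rw [hx, add_sub_add_left_eq_sub, ← sub_smul]
        congr 1
        push_cast
        ring
      rw [this, norm_smul, Real.norm_of_nonneg (by positivity), ← one_div, lt_div_iff₀ hpos,
        one_div_mul_eq_div, div_mul_eq_mul_div, div_lt_one hN0]
      calc _ ≤ ‖k‖ * C := by gcongr
        _ ≤ _ := le_max_right _ _
        _ < N := hN
  simpa [div_self hN0.ne'] using step N le_rfl

/-- An operator on continuous functions whose iterates are bounded like those of a Volterra operator
does not have `1` in its spectrum. -/
theorem isUnit_one_sub_of_iterate_bound {X G : Type*} [TopologicalSpace X] [CompactSpace X]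
    [NormedAddCommGroup G] [NormedSpace ℝ G] [CompleteSpace G] (a : C(X, G) →L[ℝ] C(X, G))
    (φ : X → ℝ) {C L : ℝ} (hC : 0 ≤ C) (hφ : ∀ t, 0 ≤ φ t) (hφL : ∀ t, φ t ≤ L)
    (h : ∀ (k : ℕ) (c : ℝ) (f : C(X, G)), 0 ≤ c → (∀ t, ‖f t‖ ≤ c * (φ t ^ k / k.factorial)) →
      ∀ t, ‖a f t‖ ≤ C * c * (φ t ^ (k + 1) / (k + 1).factorial)) : IsUnit (1 - a) := by
  have hpow : ∀ (k : ℕ) (f : C(X, G)) (t : X),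
      ‖(a ^ k) f t‖ ≤ C ^ k * ‖f‖ * (φ t ^ k / k.factorial) := by
    intro k
    induction k with
    | zero => intro f t; simpa using f.norm_coe_le_norm t
    | succ k ih =>
      intro f t
      rw [pow_succ' a, mul_apply_eq_comp]
      refine (h k _ _ (by positivity) (ih f) t).trans_eq ?_
      ring
  -- One iterate of norm below `1` is enough, and factorial decay supplies it for any size of `C *
  -- L`.
  obtain ⟨k, hk⟩ := ((FloorSemiring.tendsto_pow_div_factorial_atTop (C * L)).eventually
    (gt_mem_nhds (zero_lt_one' ℝ))).exists
  have hnorm : ‖a ^ k‖ < 1 := by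
    rcases isEmpty_or_nonempty X with hX | ⟨⟨t₀⟩⟩
    · have : a ^ k = 0 := by ext f t; exact hX.elim t
      simp [this]
    have hL : 0 ≤ L := (hφ t₀).trans (hφL t₀)
    refine lt_of_le_of_lt ?_ hk
    refine ContinuousLinearMap.opNorm_le_bound _ (by positivity) fun f => ?_
    refine (ContinuousMap.norm_le _ (by positivity)).2 fun t => (hpow k f t).trans ?_
    calc C ^ k * ‖f‖ * (φ t ^ k / k.factorial) ≤ C ^ k * ‖f‖ * (L ^ k / k.factorial) := by
          gcongr
          · exact hφ t
          · exact hφL t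
      _ = _ := by rw [mul_pow]; ring
  have hu : IsUnit (1 - a ^ k) := (Units.oneSub _ hnorm).isUnit
  -- `1 - a` is a factor of `1 - a ^ k`, and commuting factors of a unit are units.
  rw [← mul_neg_geom_sum] at hu
  have hcomm : Commute (1 - a) (∑ i ∈ Finset.range k, a ^ i) := by
    refine Commute.sum_right _ _ _ fun i _ => ?_
    exact ((Commute.one_left a).sub_left (Commute.refl a)).pow_right i
  exact (hcomm.isUnit_mul_iff.1 hu).1

/-! ### Operators on spaces of continuous paths -/

/-- Continuous paths `[s, T] → ℝ^k` with the supremum norm. -/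
abbrev Path (s T : ℝ) (k : ℕ) := C(Icc s T, Fin k → ℝ)

section Operators

variable {s T : ℝ} (h : s ≤ T) {k l : ℕ}

/-- The extension of a path to the real line by its endpoint values. -/
noncomputable def extend (f : Path s T k) : ℝ → Fin k → ℝ := IccExtend h f

theorem continuous_extend (f : Path s T k) : Continuous (extend h f) :=
  f.continuous.Icc_extend'

theorem extend_of_mem (f : Path s T k) {t : ℝ} (ht : t ∈ Icc s T) : extend h f t = f ⟨t, ht⟩ :=
  IccExtend_of_mem h f ht

theorem extend_apply_le {f : Path s T k} {c : ℝ} (hf : ∀ t, ‖f t‖ ≤ c) (t : ℝ) :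
    ‖extend h f t‖ ≤ c := hf _

theorem intervalIntegrable_extend (f : Path s T k) (a b : ℝ) :
    IntervalIntegrable (extend h f) volume a b :=
  (continuous_extend h f).intervalIntegrable a b

/-- The operator `f ↦ (t ↦ ∫_s^t f)`. -/
noncomputable def volterra (k : ℕ) : Path s T k →L[ℝ] Path s T k :=
  LinearMap.mkContinuous
    { toFun := fun f => ⟨fun t => ∫ τ in s..t, extend h f τ,
        (intervalIntegral.continuous_primitive (intervalIntegrable_extend h f) s).comp
          continuous_subtype_val⟩
      map_add' := fun f g => by
        ext1 t
        exact intervalIntegral.integral_add (intervalIntegrable_extend h f _ _)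
          (intervalIntegrable_extend h g _ _)
      map_smul' := fun c f => by
        ext1 t
        exact intervalIntegral.integral_smul c _ }
    (T - s) fun f => by
      refine (ContinuousMap.norm_le _ (mul_nonneg (sub_nonneg.2 h) (norm_nonneg _))).2 fun t => ?_
      refine (intervalIntegral.norm_integral_le_of_norm_le_const (C := ‖f‖) fun τ _ =>
        extend_apply_le h f.norm_coe_le_norm τ).trans ?_
      rw [mul_comm, abs_of_nonneg (sub_nonneg.2 t.2.1)]
      gcongr
      exact t.2.2

/-- The endpoint evaluation `f ↦ f(T)`, as a constant path. -/
noncomputable def endpoint (k : ℕ) : Path s T k →L[ℝ] Path s T k :=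
  ContinuousLinearMap.const ℝ (Icc s T) ∘L ContinuousMap.evalCLM ℝ (⟨T, right_mem_Icc.2 h⟩ : Icc s T)

theorem endpoint_apply (f : Path s T k) (t : Icc s T) :
    endpoint h k f t = f ⟨T, right_mem_Icc.2 h⟩ := rfl

/-- The operator `f ↦ (t ↦ ∫_t^T f)`. -/
noncomputable def volterraTail (k : ℕ) : Path s T k →L[ℝ] Path s T k :=
  endpoint h k ∘L volterra h k - volterra h k

theorem volterraTail_apply (f : Path s T k) (t : Icc s T) :
    volterraTail h k f t = ∫ τ in t..T, extend h f τ := by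
  have := intervalIntegral.integral_interval_sub_left (intervalIntegrable_extend h f s T)
    (intervalIntegrable_extend h f s t)
  rw [← this]
  rfl

/-- Pointwise application of a matrix. -/
noncomputable def matrixOp (M : Matrix (Fin l) (Fin k) ℝ) : Path s T k →L[ℝ] Path s T l :=
  (LinearMap.toContinuousLinearMap M.mulVecLin).compLeftContinuous ℝ (Icc s T)

@[simp]
theorem matrixOp_apply (M : Matrix (Fin l) (Fin k) ℝ) (f : Path s T k) (t : Icc s T) :
    matrixOp M f t = M *ᵥ f t := rfl

theorem extend_matrixOp (M : Matrix (Fin l) (Fin k) ℝ) (f : Path s T k) (t : ℝ) :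
    extend h (matrixOp M f) t = M *ᵥ extend h f t := rfl

theorem extend_add (f g : Path s T k) (t : ℝ) :
    extend h (f + g) t = extend h f t + extend h g t := rfl

theorem continuous_matrixOp :
    Continuous (matrixOp : Matrix (Fin l) (Fin k) ℝ → Path s T k →L[ℝ] Path s T l) := by
  let Φ : Matrix (Fin l) (Fin k) ℝ →ₗ[ℝ] (Path s T k →L[ℝ] Path s T l) :=
    { toFun := matrixOp
      map_add' := fun M N => by ext1 f; ext1 t; exact Matrix.add_mulVec M N (f t)
      map_smul' := fun c M => by ext1 f; ext1 t; exact Matrix.smul_mulVec c M (f t) }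
  exact Φ.continuous_of_finiteDimensional

/-- One integration turns the weight `(t - s)^j / j!` into the weight with `j + 1`, so no smallness
of `A` or of `T - s` is needed. -/
theorem isUnit_one_sub_volterra (A : Matrix (Fin k) (Fin k) ℝ) :
    IsUnit (1 - volterra h k ∘L matrixOp A) := by
  set α := ‖(LinearMap.toContinuousLinearMap A.mulVecLin)‖
  have hA : ∀ v, ‖A *ᵥ v‖ ≤ α * ‖v‖ :=
    (LinearMap.toContinuousLinearMap A.mulVecLin).le_opNorm
  refine isUnit_one_sub_of_iterate_bound _ (fun t => t - s) (C := α) (L := T - s) (norm_nonneg _)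
    (fun t => sub_nonneg.2 t.2.1) (fun t => sub_le_sub_right t.2.2 s) fun j c f hc hf t => ?_
  have hb : ∀ τ ∈ Ioc s (t : ℝ), ‖extend h (matrixOp A f) τ‖ ≤
      α * c / j.factorial * (τ - s) ^ j := fun τ hτ => by
    rw [extend_of_mem h _ ⟨hτ.1.le, hτ.2.trans t.2.2⟩, matrixOp_apply]
    refine (hA _).trans ((mul_le_mul_of_nonneg_left (hf _) (norm_nonneg _)).trans_eq ?_)
    ring
  have := intervalIntegral.norm_integral_le_of_norm_le t.2.1
    (μ := volume) (ae_of_all _ hb) (Continuous.intervalIntegrable (by fun_prop) _ _)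
  refine this.trans_eq ?_
  rw [intervalIntegral.integral_const_mul,
    intervalIntegral.integral_comp_sub_right (fun x => x ^ j), integral_pow, Nat.factorial_succ]
  push_cast
  field_simp
  simp

/-- The same estimate with time reversed, the weight being built on `T - t`. -/
theorem isUnit_one_sub_volterraTail (A : Matrix (Fin k) (Fin k) ℝ) :
    IsUnit (1 - volterraTail h k ∘L matrixOp A) := by
  set α := ‖(LinearMap.toContinuousLinearMap A.mulVecLin)‖
  have hA : ∀ v, ‖A *ᵥ v‖ ≤ α * ‖v‖ :=
    (LinearMap.toContinuousLinearMap A.mulVecLin).le_opNorm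
  refine isUnit_one_sub_of_iterate_bound _ (fun t => T - t) (C := α) (L := T - s) (norm_nonneg _)
    (fun t => sub_nonneg.2 t.2.2) (fun t => sub_le_sub_left t.2.1 T) fun j c f hc hf t => ?_
  have hb : ∀ τ ∈ Ioc (t : ℝ) T, ‖extend h (matrixOp A f) τ‖ ≤
      α * c / j.factorial * (T - τ) ^ j := fun τ hτ => by
    rw [extend_of_mem h _ ⟨t.2.1.trans hτ.1.le, hτ.2⟩, matrixOp_apply]
    refine (hA _).trans ((mul_le_mul_of_nonneg_left (hf _) (norm_nonneg _)).trans_eq ?_)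
    ring
  have := intervalIntegral.norm_integral_le_of_norm_le t.2.2
    (μ := volume) (ae_of_all _ hb) (Continuous.intervalIntegrable (by fun_prop) _ _)
  rw [ContinuousLinearMap.comp_apply, volterraTail_apply]
  refine this.trans_eq ?_
  rw [intervalIntegral.integral_const_mul,
    intervalIntegral.integral_comp_sub_left (fun x => x ^ j), integral_pow, Nat.factorial_succ]
  push_cast
  field_simp
  simp

end Operators

/-! ### State, costate and response operators, and their continuity in the matrix -/

theorem continuousAt_ringInverse {𝓡 : Type*} [NormedRing 𝓡] [CompleteSpace 𝓡] {a : 𝓡}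
    (ha : IsUnit a) : ContinuousAt Ring.inverse a := by
  obtain ⟨x, rfl⟩ := ha
  exact NormedRing.inverse_continuousAt x

section StateCostate

variable {s T : ℝ} (h : s ≤ T) {n m : ℕ}

/-- The solution operator `y ↦ x` of `x = y + ∫_s^t A x`. -/
noncomputable def stateOp (A : Matrix (Fin n) (Fin n) ℝ) : Path s T n →L[ℝ] Path s T n :=
  Ring.inverse (1 - volterra h n ∘L matrixOp A)

/-- `Ring.inverse` takes the value `0` at non-units; invertibility of the Volterra operator makes it
a genuine inverse here. -/
theorem stateOp_eq (A : Matrix (Fin n) (Fin n) ℝ) (y : Path s T n) :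
    stateOp h A y = y + volterra h n (matrixOp A (stateOp h A y)) := by
  have := congr($(Ring.mul_inverse_cancel _ (isUnit_one_sub_volterra h A)) y)
  exact sub_eq_iff_eq_add.1 this

/-- The operator `x ↦ p` solving `p(t) = Q_f x(T) + ∫_t^T (Aᵀ p + Q x)`. -/
noncomputable def costateOp (Q Qf A : Matrix (Fin n) (Fin n) ℝ) : Path s T n →L[ℝ] Path s T n :=
  Ring.inverse (1 - volterraTail h n ∘L matrixOp Aᵀ) ∘L
    (endpoint h n ∘L matrixOp Qf + volterraTail h n ∘L matrixOp Q)

theorem costateOp_eq (Q Qf A : Matrix (Fin n) (Fin n) ℝ) (x : Path s T n) :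
    costateOp h Q Qf A x = endpoint h n (matrixOp Qf x) +
      volterraTail h n (matrixOp Aᵀ (costateOp h Q Qf A x) + matrixOp Q x) := by
  have := congr($(Ring.mul_inverse_cancel _ (isUnit_one_sub_volterraTail h Aᵀ))
    (endpoint h n (matrixOp Qf x) + volterraTail h n (matrixOp Q x)))
  rw [map_add, add_comm (volterraTail _ _ _), ← add_assoc]
  exact sub_eq_iff_eq_add.1 this

theorem continuous_stateOp :
    Continuous (stateOp h : Matrix (Fin n) (Fin n) ℝ → Path s T n →L[ℝ] Path s T n) := by
  refine continuous_iff_continuousAt.2 fun A => ?_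
  refine ContinuousAt.comp (g := Ring.inverse)
    (f := fun A => (1 - volterra h n ∘L matrixOp A)) ?_ ?_
  · exact continuousAt_ringInverse (𝓡 := Path s T n →L[ℝ] Path s T n) (isUnit_one_sub_volterra h A)
  · exact (continuous_const.sub (continuous_const.clm_comp continuous_matrixOp)).continuousAt

theorem continuous_costateOp (Q Qf : Matrix (Fin n) (Fin n) ℝ) :
    Continuous (costateOp h Q Qf : Matrix (Fin n) (Fin n) ℝ → Path s T n →L[ℝ] Path s T n) := by
  refine Continuous.clm_comp (continuous_iff_continuousAt.2 fun A => ?_) continuous_const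
  refine ContinuousAt.comp (g := Ring.inverse)
    (f := fun A => (1 - volterraTail h n ∘L matrixOp Aᵀ)) ?_ ?_
  · exact continuousAt_ringInverse (𝓡 := Path s T n →L[ℝ] Path s T n)
      (isUnit_one_sub_volterraTail h Aᵀ)
  · exact (continuous_const.sub (continuous_const.clm_comp
      (continuous_matrixOp.comp continuous_id.matrix_transpose))).continuousAt

/-- The operator taking the forcing term of the state equation to `Bᵀ p`. -/
noncomputable def responseOp (B : Matrix (Fin n) (Fin m) ℝ) (Q Qf A : Matrix (Fin n) (Fin n) ℝ) :
    Path s T n →L[ℝ] Path s T m :=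
  matrixOp Bᵀ ∘L costateOp h Q Qf A ∘L stateOp h A

theorem continuous_responseOp (B : Matrix (Fin n) (Fin m) ℝ) (Q Qf : Matrix (Fin n) (Fin n) ℝ) :
    Continuous (responseOp h B Q Qf) :=
  continuous_const.clm_comp ((continuous_costateOp h Q Qf).clm_comp (continuous_stateOp h))

/-- The forcing term `x₀ + ∫_s^t B u` of the state equation. -/
noncomputable def forcing (B : Matrix (Fin n) (Fin m) ℝ) (x₀ : Fin n → ℝ) (u : Path s T m) :
    Path s T n :=
  ContinuousMap.const _ x₀ + volterra h n (matrixOp B u)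

/-- The state driven by a continuous control. -/
noncomputable def state (A : Matrix (Fin n) (Fin n) ℝ) (B : Matrix (Fin n) (Fin m) ℝ)
    (x₀ : Fin n → ℝ) (u : Path s T m) : Path s T n :=
  stateOp h A (forcing h B x₀ u)

theorem isTrajectory_state (A : Matrix (Fin n) (Fin n) ℝ) (B : Matrix (Fin n) (Fin m) ℝ)
    (x₀ : Fin n → ℝ) (u : Path s T m) :
    IsTrajectory A B s T x₀ (extend h u) (extend h (state h A B x₀ u)) := by
  refine ⟨(intervalIntegrable_extend h (matrixOp A (state h A B x₀ u) + matrixOp B u) s T), ?_⟩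
  intro t ht
  have := congr($(stateOp_eq h A (forcing h B x₀ u)) ⟨t, ht⟩)
  rw [extend_of_mem h _ ht]
  refine this.trans ?_
  have hadd : ∫ τ in s..t, (A *ᵥ extend h (state h A B x₀ u) τ + B *ᵥ extend h u τ) =
      volterra h n (matrixOp A (state h A B x₀ u) + matrixOp B u) ⟨t, ht⟩ := rfl
  rw [hadd, map_add, add_comm (volterra _ _ _), ContinuousMap.add_apply, ContinuousMap.add_apply,
    ← add_assoc]
  rfl

end StateCostate

/-! ### Integration by parts -/

/-- Both primitives are absolutely continuous, so integration by parts survives for a merely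
integrable `g`. The boundary term at `s` vanishes because `ζ s = 0`. -/
theorem integral_mul_eq_of_primitives {s T : ℝ} (h : s ≤ T) {q₁ g ζ : ℝ → ℝ} (qT : ℝ)
    {q : ℝ → ℝ} (hq₁ : Continuous q₁) (hg : IntervalIntegrable g volume s T)
    (hq : ∀ t ∈ Icc s T, q t = qT + ∫ τ in t..T, q₁ τ)
    (hζ : ∀ t ∈ Icc s T, ζ t = ∫ τ in s..t, g τ) :
    ∫ t in s..T, q t * g t = qT * ζ T + ∫ t in s..T, q₁ t * ζ t := by
  have hq₁i := fun a b => hq₁.intervalIntegrable (μ := volume) a b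
  have hF := (hq₁i s T).absolutelyContinuousOnInterval_intervalIntegral (c := s) (by simp)
  have hZ := hg.absolutelyContinuousOnInterval_intervalIntegral (c := s) (by simp)
  have hIBP := hF.integral_mul_deriv_eq_deriv_mul hZ
  have e1 : ∫ t in s..T, (∫ τ in s..t, q₁ τ) * deriv (fun x => ∫ τ in s..x, g τ) t =
      ∫ t in s..T, (∫ τ in s..t, q₁ τ) * g t := by
    refine intervalIntegral.integral_congr_ae ?_
    filter_upwards [hg.ae_hasDerivAt_integral] with t ht hmem
    rw [(ht (uIoc_subset_uIcc hmem) s (by simp)).deriv]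
  have e2 : ∫ t in s..T, deriv (fun x => ∫ τ in s..x, q₁ τ) t * (∫ τ in s..t, g τ) =
      ∫ t in s..T, q₁ t * ζ t := by
    refine intervalIntegral.integral_congr fun t ht => ?_
    rw [uIcc_of_le h] at ht
    simp only [hζ t ht]
    rw [(hq₁.integral_hasStrictDerivAt s t).hasDerivAt.deriv]
  have e3 : ∫ t in s..T, q t * g t =
      ∫ t in s..T, ((qT + ∫ τ in s..T, q₁ τ) * g t - (∫ τ in s..t, q₁ τ) * g t) := by
    refine intervalIntegral.integral_congr fun t ht => ?_
    rw [uIcc_of_le h] at ht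
    simp only [hq t ht]
    rw [← intervalIntegral.integral_interval_sub_left (hq₁i s T) (hq₁i s t)]
    ring
  rw [e1, e2, intervalIntegral.integral_same, ← hζ T (right_mem_Icc.2 h)] at hIBP
  rw [e3, intervalIntegral.integral_sub (hg.const_mul _)
    (hg.continuousOn_mul hF.continuousOn), hIBP, intervalIntegral.integral_const_mul,
    ← hζ T (right_mem_Icc.2 h)]
  ring

theorem intervalIntegrable_dotProduct {s T : ℝ} {k : ℕ} {p g : ℝ → Fin k → ℝ}
    (hp : ContinuousOn p (uIcc s T)) (hg : IntervalIntegrable g volume s T) :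
    IntervalIntegrable (fun t => p t ⬝ᵥ g t) volume s T := by
  have hterm : ∀ i, IntervalIntegrable (fun t => p t i * g t i) volume s T := fun i =>
    IntervalIntegrable.continuousOn_mul
    ⟨hg.1.eval i, hg.2.eval i⟩ ((continuous_apply i).comp_continuousOn hp)
  exact ⟨integrable_finsetSum _ fun i _ => (hterm i).1,
    integrable_finsetSum _ fun i _ => (hterm i).2⟩

theorem integral_dotProduct_eq_of_primitives {s T : ℝ} (h : s ≤ T) {k : ℕ}
    {q₁ q g ζ : ℝ → Fin k → ℝ} (qT : Fin k → ℝ) (hq₁ : Continuous q₁)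
    (hqc : ContinuousOn q (Icc s T)) (hζc : ContinuousOn ζ (Icc s T))
    (hg : IntervalIntegrable g volume s T)
    (hq : ∀ t ∈ Icc s T, q t = qT + ∫ τ in t..T, q₁ τ)
    (hζ : ∀ t ∈ Icc s T, ζ t = ∫ τ in s..t, g τ) :
    ∫ t in s..T, q t ⬝ᵥ g t = qT ⬝ᵥ ζ T + ∫ t in s..T, q₁ t ⬝ᵥ ζ t := by
  have hgi : ∀ i, IntervalIntegrable (fun t => g t i) volume s T := fun i =>
    ⟨hg.1.eval i, hg.2.eval i⟩
  have happ : ∀ {f : ℝ → Fin k → ℝ} {a b : ℝ}, IntervalIntegrable f volume a b → ∀ i,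
      (∫ τ in a..b, f τ) i = ∫ τ in a..b, f τ i := fun hf i =>
    ((ContinuousLinearMap.proj (R := ℝ) (φ := fun _ => ℝ) i).intervalIntegral_comp_comm hf).symm
  simp only [dotProduct]
  rw [intervalIntegral.integral_finsetSum, intervalIntegral.integral_finsetSum,
    ← Finset.sum_add_distrib]
  · refine Finset.sum_congr rfl fun i _ => ?_
    refine integral_mul_eq_of_primitives (q₁ := fun t => q₁ t i) (ζ := fun t => ζ t i) h (qT i)
      ((continuous_apply i).comp hq₁) (hgi i) (fun t ht => ?_) (fun t ht => ?_)
    · rw [hq t ht, Pi.add_apply, happ (hq₁.intervalIntegrable _ _)]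
    · rw [hζ t ht, happ (hg.mono_set ?_)]
      rw [uIcc_of_le h, uIcc_of_le ht.1]
      exact Icc_subset_Icc_right ht.2
  · intro i _
    refine ContinuousOn.intervalIntegrable ?_
    rw [uIcc_of_le h]
    exact ((continuous_apply i).comp hq₁).continuousOn.mul
      ((continuous_apply i).comp_continuousOn hζc)
  · intro i _
    refine (hgi i).continuousOn_mul ?_
    rw [uIcc_of_le h]
    exact (continuous_apply i).comp_continuousOn hqc

/-- The adjoint identity for the costate `p` of a path `x` and a perturbation `(z, w)` of the state
and the control. -/
theorem integral_costate_dotProduct {s T : ℝ} (h : s ≤ T) {n m : ℕ}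
    (A : Matrix (Fin n) (Fin n) ℝ) (B : Matrix (Fin n) (Fin m) ℝ) (Q Qf : Matrix (Fin n) (Fin n) ℝ)
    (x : Path s T n) {z : ℝ → Fin n → ℝ} {w : ℝ → Fin m → ℝ}
    (hzc : ContinuousOn z (Icc s T)) (hz : IsTrajectory A B s T 0 w z) :
    ∫ t in s..T, extend h (costateOp h Q Qf A x) t ⬝ᵥ (B *ᵥ w t) =
      (Qf *ᵥ extend h x T) ⬝ᵥ z T + ∫ t in s..T, (Q *ᵥ extend h x t) ⬝ᵥ z t := by
  set p := costateOp h Q Qf A x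
  have hpc := continuous_extend h p
  have hzc' : ContinuousOn z (uIcc s T) := by rwa [uIcc_of_le h]
  have hAz : ContinuousOn (fun t => A *ᵥ z t) (uIcc s T) := 
    (LinearMap.toContinuousLinearMap A.mulVecLin).continuous.comp_continuousOn hzc'
  have hIBP := integral_dotProduct_eq_of_primitives h (q := extend h p)
    (q₁ := extend h (matrixOp Aᵀ p + matrixOp Q x))
    (Qf *ᵥ extend h x T) (continuous_extend h _) hpc.continuousOn hzc hz.1
    (fun t ht => by
      have := congr($(costateOp_eq h Q Qf A x) ⟨t, ht⟩)
      rw [extend_of_mem h _ ht, extend_of_mem h _ (right_mem_Icc.2 h)]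
      refine this.trans ?_
      rw [ContinuousMap.add_apply, endpoint_apply, volterraTail_apply, matrixOp_apply])
    (fun t ht => by rw [hz.2 t ht, zero_add])
  have i1 : IntervalIntegrable (fun t => extend h p t ⬝ᵥ (A *ᵥ z t)) volume s T :=
    intervalIntegrable_dotProduct hpc.continuousOn hAz.intervalIntegrable
  -- No integrability of `w` is available: a trajectory only makes the sum `A z + B w` integrable,
  -- and the continuous part `A z` is subtracted.
  have i2 : IntervalIntegrable (fun t => extend h p t ⬝ᵥ (B *ᵥ w t)) volume s T := by
    have := (intervalIntegrable_dotProduct hpc.continuousOn hz.1).sub i1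
    refine this.congr fun t _ => ?_
    simp only [dotProduct_add]
    ring
  have i3 : IntervalIntegrable (fun t => (Q *ᵥ extend h x t) ⬝ᵥ z t) volume s T :=
    intervalIntegrable_dotProduct (continuous_extend h (matrixOp Q x)).continuousOn
      hzc'.intervalIntegrable
  -- With this the two terms containing `A` cancel; the costate equation is designed for that.
  have e : ∀ t, (Aᵀ *ᵥ extend h p t) ⬝ᵥ z t = extend h p t ⬝ᵥ (A *ᵥ z t) := fun t => by
    rw [Matrix.mulVec_transpose, Matrix.dotProduct_mulVec]
  simp only [extend_add, extend_matrixOp, dotProduct_add, add_dotProduct, e] at hIBP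
  rw [intervalIntegral.integral_add i1 i2, intervalIntegral.integral_add i1 i3] at hIBP
  linarith

/-! ### Invertibility of the feedback operator -/

theorem abs_dotProduct_le {k : ℕ} (a b : Fin k → ℝ) : |a ⬝ᵥ b| ≤ k * ‖a‖ * ‖b‖ := by
  calc |a ⬝ᵥ b| ≤ ∑ i : Fin k, |a i * b i| := Finset.abs_sum_le_sum_abs _ _
    _ ≤ ∑ _i : Fin k, ‖a‖ * ‖b‖ := by
        refine Finset.sum_le_sum fun i _ => ?_
        rw [abs_mul]
        exact mul_le_mul (norm_le_pi_norm a i) (norm_le_pi_norm b i) (abs_nonneg _) (norm_nonneg _)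
    _ = k * ‖a‖ * ‖b‖ := by simp [mul_assoc]

theorem exists_coercive {m : ℕ} {R : Matrix (Fin m) (Fin m) ℝ} (hR : R.PosDef) :
    ∃ r > 0, ∀ v, r * ‖v‖ ^ 2 ≤ v ⬝ᵥ (R *ᵥ v) := by
  have hpos : ∀ v, v ≠ 0 → 0 < v ⬝ᵥ (R *ᵥ v) := fun v hv => by
    simpa using hR.dotProduct_mulVec_pos hv
  have hcont : Continuous fun v : Fin m → ℝ => v ⬝ᵥ (R *ᵥ v) := by fun_prop
  have hscale : ∀ (c : ℝ) (v : Fin m → ℝ), (c • v) ⬝ᵥ (R *ᵥ (c • v)) = c ^ 2 * (v ⬝ᵥ (R *ᵥ v)) :=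
    fun c v => by
      rw [Matrix.mulVec_smul, smul_dotProduct, dotProduct_smul, smul_eq_mul, smul_eq_mul]; ring
  have hsphere : ∀ v : Fin m → ℝ, v ≠ 0 → ‖v‖⁻¹ • v ∈ Metric.sphere (0 : Fin m → ℝ) 1 :=
    fun v hv => by simp [norm_smul, inv_mul_cancel₀ (norm_ne_zero_iff.2 hv)]
  -- The sphere is empty exactly when `m = 0`, and then any constant works; otherwise the minimum on
  -- the compact sphere is the constant, by homogeneity.
  rcases (Metric.sphere (0 : Fin m → ℝ) 1).eq_empty_or_nonempty with he | hne
  · refine ⟨1, one_pos, fun v => ?_⟩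
    rcases eq_or_ne v 0 with rfl | hv
    · simp
    · exact absurd (hsphere v hv) (by simp [he])
  · obtain ⟨v₀, hv₀, hmin⟩ := (isCompact_sphere (0 : Fin m → ℝ) 1).exists_isMinOn hne
      hcont.continuousOn
    refine ⟨v₀ ⬝ᵥ (R *ᵥ v₀), hpos v₀ (Metric.ne_of_mem_sphere hv₀ one_ne_zero), fun v => ?_⟩
    rcases eq_or_ne v 0 with rfl | hv
    · simp
    · have h1 : v₀ ⬝ᵥ (R *ᵥ v₀) ≤ (‖v‖⁻¹ • v) ⬝ᵥ (R *ᵥ (‖v‖⁻¹ • v)) := hmin (hsphere v hv)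
      have h2 : 0 < ‖v‖ := norm_pos_iff.2 hv
      rw [hscale, inv_pow, inv_mul_eq_div, le_div_iff₀ (by positivity)] at h1
      exact h1

section Pairing

variable {s T : ℝ} (h : s ≤ T) {m : ℕ}

/-- The pairing `f ↦ ∫_s^T f · w` with an integrable function `w`. -/
noncomputable def pairing {w : ℝ → Fin m → ℝ} (hw : IntervalIntegrable w volume s T) :
    Path s T m →L[ℝ] ℝ :=
  LinearMap.mkContinuous
    { toFun := fun f => ∫ t in s..T, extend h f t ⬝ᵥ w t
      map_add' := fun f g => by
        rw [← intervalIntegral.integral_add]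
        · simp only [extend_add, add_dotProduct]
        · exact intervalIntegrable_dotProduct (continuous_extend h f).continuousOn hw
        · exact intervalIntegrable_dotProduct (continuous_extend h g).continuousOn hw
      map_smul' := fun c f => by
        rw [RingHom.id_apply, ← intervalIntegral.integral_smul]
        refine intervalIntegral.integral_congr fun t _ => ?_
        exact smul_dotProduct c (extend h f t) (w t) }
    (m * ∫ t in s..T, ‖w t‖) fun f => by
      refine (intervalIntegral.norm_integral_le_of_norm_le (g := fun t => m * ‖f‖ * ‖w t‖) h
        (ae_of_all _ fun t _ => ?_) (hw.norm.const_mul _)).trans_eq ?_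
      · refine (abs_dotProduct_le _ _).trans ?_
        gcongr
        exact extend_apply_le h f.norm_coe_le_norm t
      · rw [intervalIntegral.integral_const_mul]; ring

theorem pairing_apply {w : ℝ → Fin m → ℝ} (hw : IntervalIntegrable w volume s T)
    (f : Path s T m) : pairing h hw f = ∫ t in s..T, extend h f t ⬝ᵥ w t := rfl

end Pairing

section Feedback

variable {s T : ℝ} (h : s ≤ T) {n m : ℕ}

/-- The operator `u ↦ R u + M (∫_s^t B u)`. -/
noncomputable def feedbackOp (B : Matrix (Fin n) (Fin m) ℝ) (R : Matrix (Fin m) (Fin m) ℝ)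
    (M : Path s T n →L[ℝ] Path s T m) : Path s T m →L[ℝ] Path s T m :=
  matrixOp R + M ∘L volterra h n ∘L matrixOp B

theorem isUnit_matrixOp {R : Matrix (Fin m) (Fin m) ℝ} (hR : IsUnit R.det) :
    IsUnit (matrixOp R : Path s T m →L[ℝ] Path s T m) := by
  refine ⟨⟨matrixOp R, matrixOp R⁻¹, ?_, ?_⟩, rfl⟩
  · ext1 f; ext1 t
    change R *ᵥ (R⁻¹ *ᵥ f t) = f t
    rw [Matrix.mulVec_mulVec, Matrix.mul_nonsing_inv _ hR, Matrix.one_mulVec]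
  · ext1 f; ext1 t
    change R⁻¹ *ᵥ (R *ᵥ f t) = f t
    rw [Matrix.mulVec_mulVec, Matrix.nonsing_inv_mul _ hR, Matrix.one_mulVec]

/-- Completing the square bounds `r y² - κ y` below by an affine function of `y`, which turns the
quadratic hypothesis into an `L¹` bound. -/
theorem integral_norm_le_of_coercive (h : s ≤ T) {r κ : ℝ} (hr : 0 < r) (hκ : 0 ≤ κ) {y : ℝ → ℝ}
    (hy : Continuous y) (hy0 : ∀ t, 0 ≤ y t) (hint : ∫ t in s..T, (r * y t ^ 2 - κ * y t) ≤ 0) :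
    ∫ t in s..T, y t ≤ κ * (T - s) / r := by
  have hi : ∀ {f : ℝ → ℝ}, Continuous f → IntervalIntegrable f volume s T :=
    fun hf => hf.intervalIntegrable _ _
  -- `κ` may vanish, so it is enlarged by `ε` to allow division by `K`; the limit `ε → 0` removes
  -- this.
  have aux : ∀ ε > 0, ∫ t in s..T, y t ≤ (κ + ε) * (T - s) / r := by
    intro ε hε
    set K := κ + ε
    have hK : 0 < K := by positivity
    have hpt : ∀ t, K * y t - K ^ 2 / r ≤ r * y t ^ 2 - κ * y t := fun t => by
      have h1 : r * y t ^ 2 - 2 * K * y t + K ^ 2 / r = (r * y t - K) ^ 2 / r := by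
        field_simp
        ring
      have h2 : 0 ≤ (r * y t - K) ^ 2 / r := by positivity
      have h3 : 0 ≤ ε * y t := mul_nonneg hε.le (hy0 t)
      have h4 : K * y t = κ * y t + ε * y t := by ring
      linarith
    have h5 := (intervalIntegral.integral_mono_on (μ := volume) h (hi (by fun_prop))
      (hi (by fun_prop)) fun t _ => hpt t).trans hint
    rw [intervalIntegral.integral_sub (hi (by fun_prop)) (hi (by fun_prop)),
      intervalIntegral.integral_const_mul, intervalIntegral.integral_const, smul_eq_mul] at h5
    have h6 : K * (∫ t in s..T, y t) ≤ K * (K * (T - s) / r) := by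
      have : K * (K * (T - s) / r) = (T - s) * (K ^ 2 / r) := by ring
      linarith
    exact le_of_mul_le_mul_left h6 hK
  have hlim : Tendsto (fun ε : ℝ => (κ + ε) * (T - s) / r) (𝓝[>] 0) (𝓝 (κ * (T - s) / r)) := by
    have : Continuous fun ε : ℝ => (κ + ε) * (T - s) / r := by fun_prop
    exact (this.tendsto' 0 _ (by simp)).mono_left nhdsWithin_le_nhds
  exact ge_of_tendsto hlim (eventually_mem_nhdsWithin.mono aux)

/-- Pairing the equation with `u` and dropping the monotone term gives an `L¹` bound on `u` by
coercivity. The integral `∫_s^t B u` is then bounded in supremum norm, and solving the equation for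
`u` through `R⁻¹` raises the bound on `u` to the supremum norm. Nothing depends on `c`, as the
method of continuity requires. -/
theorem norm_le_of_feedback_eq {B : Matrix (Fin n) (Fin m) ℝ} {R : Matrix (Fin m) (Fin m) ℝ}
    (hR : R.PosDef) (M : Path s T n →L[ℝ] Path s T m)
    (hM : ∀ u : Path s T m,
      0 ≤ ∫ t in s..T, extend h (M (volterra h n (matrixOp B u))) t ⬝ᵥ extend h u t) :
    ∃ C : ℝ, ∀ c ∈ Icc (0 : ℝ) 1, ∀ u f : Path s T m,
      matrixOp R u + c • M (volterra h n (matrixOp B u)) = f → ‖u‖ ≤ C * ‖f‖ := by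
  obtain ⟨r, hr, hRr⟩ := exists_coercive hR
  have hdet : IsUnit R.det := hR.det_pos.ne'.isUnit
  set β := ‖(LinearMap.toContinuousLinearMap B.mulVecLin)‖
  have hB : ∀ v, ‖B *ᵥ v‖ ≤ β * ‖v‖ :=
    (LinearMap.toContinuousLinearMap B.mulVecLin).le_opNorm
  set ρ := ‖(matrixOp R⁻¹ : Path s T m →L[ℝ] Path s T m)‖
  refine ⟨ρ * (1 + ‖M‖ * (β * (m * (T - s) / r))), fun c hc u f hf => ?_⟩
  have hu := continuous_extend h u
  have hy : Continuous fun t => ‖extend h u t‖ := hu.norm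
  have hi : ∀ {f : ℝ → ℝ}, Continuous f → IntervalIntegrable f volume s T :=
    fun hf => hf.intervalIntegrable _ _
  set g := M (volterra h n (matrixOp B u))
  have hg := continuous_extend h g
  have hL1 : ∫ t in s..T, ‖extend h u t‖ ≤ m * ‖f‖ * (T - s) / r := by
    refine integral_norm_le_of_coercive h hr (by positivity) hy (fun _ => norm_nonneg _) ?_
    have hle : ∀ t, r * ‖extend h u t‖ ^ 2 - m * ‖f‖ * ‖extend h u t‖ ≤
        -(c * (extend h g t ⬝ᵥ extend h u t)) := fun t => by
      have h1 := hRr (extend h u t)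
      have h2 := abs_le.1 (abs_dotProduct_le (extend h f t) (extend h u t))
      have h3 : extend h f t = R *ᵥ extend h u t + c • extend h g t := by rw [← hf]; rfl
      have h4 : extend h f t ⬝ᵥ extend h u t = extend h u t ⬝ᵥ (R *ᵥ extend h u t) +
          c * (extend h g t ⬝ᵥ extend h u t) := by
        rw [h3, add_dotProduct, smul_dotProduct, dotProduct_comm, smul_eq_mul]
      have h5 : m * ‖extend h f t‖ * ‖extend h u t‖ ≤ m * ‖f‖ * ‖extend h u t‖ := by
        gcongr
        exact extend_apply_le h f.norm_coe_le_norm t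
      linarith [h2.2]
    have hmono := intervalIntegral.integral_mono_on (μ := volume) h (hi (by fun_prop))
      (hi (by fun_prop)) fun t _ => hle t
    refine hmono.trans ?_
    rw [intervalIntegral.integral_neg, intervalIntegral.integral_const_mul, neg_nonpos]
    exact mul_nonneg hc.1 (hM u)
  have hV : ‖volterra h n (matrixOp B u)‖ ≤ β * (m * ‖f‖ * (T - s) / r) := by
    have hnn : 0 ≤ ∫ t in s..T, ‖extend h u t‖ :=
      intervalIntegral.integral_nonneg h fun t _ => norm_nonneg _
    refine (ContinuousMap.norm_le _ (mul_nonneg (norm_nonneg _) (hnn.trans hL1))).2 fun t => ?_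
    calc _ ≤ ∫ τ in s..t, β * ‖extend h u τ‖ :=
          intervalIntegral.norm_integral_le_of_norm_le t.2.1
            (ae_of_all _ fun τ _ => hB _) ((hy.const_mul β).intervalIntegrable _ _)
      _ ≤ ∫ τ in s..T, β * ‖extend h u τ‖ :=
          intervalIntegral.integral_mono_interval le_rfl t.2.1 t.2.2
            (ae_of_all _ fun τ => mul_nonneg (norm_nonneg _) (norm_nonneg _)) (hi (by fun_prop))
      _ ≤ _ := by
          rw [intervalIntegral.integral_const_mul]
          exact mul_le_mul_of_nonneg_left hL1 (norm_nonneg _)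
  have hRu : u = matrixOp R⁻¹ (f - c • g) := by
    rw [← hf, add_sub_cancel_right]
    ext1 t
    rw [matrixOp_apply, matrixOp_apply, Matrix.mulVec_mulVec, Matrix.nonsing_inv_mul _ hdet,
      Matrix.one_mulVec]
  calc ‖u‖ ≤ ρ * ‖f - c • g‖ := by
        conv_lhs => rw [hRu]
        exact ContinuousLinearMap.le_opNorm _ _
    _ ≤ ρ * (‖f‖ + 1 * (‖M‖ * (β * (m * ‖f‖ * (T - s) / r)))) := by
        gcongr
        refine (norm_sub_le _ _).trans ?_
        rw [norm_smul, Real.norm_of_nonneg hc.1]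
        gcongr
        · exact hc.2
        · exact (M.le_opNorm _).trans (by gcongr)
    _ = _ := by ring

theorem isUnit_feedbackOp {B : Matrix (Fin n) (Fin m) ℝ} {R : Matrix (Fin m) (Fin m) ℝ}
    (hR : R.PosDef) (M : Path s T n →L[ℝ] Path s T m)
    (hM : ∀ u : Path s T m,
      0 ≤ ∫ t in s..T, extend h (M (volterra h n (matrixOp B u))) t ⬝ᵥ extend h u t) :
    IsUnit (feedbackOp h B R M) := by
  obtain ⟨C, hC⟩ := norm_le_of_feedback_eq h hR M hM
  refine isUnit_add_of_forall_norm_le (𝓡 := Path s T m →L[ℝ] Path s T m) (C := max C 0)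
    (isUnit_matrixOp hR.det_pos.ne'.isUnit) fun c hc b hb => ?_
  refine ContinuousLinearMap.opNorm_le_bound _ (le_max_right _ _) fun f => ?_
  exact (hC c hc (b f) f congr($hb f)).trans (by gcongr; exact le_max_left _ _)

/-- The response operator is monotone as an operator of the control. -/
theorem integral_responseOp_nonneg (B : Matrix (Fin n) (Fin m) ℝ)
    {Q Qf : Matrix (Fin n) (Fin n) ℝ} (hQ : Q.PosSemidef) (hQf : Qf.PosSemidef)
    (A : Matrix (Fin n) (Fin n) ℝ) (u : Path s T m) :
    0 ≤ ∫ t in s..T,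
      extend h (responseOp h B Q Qf A (volterra h n (matrixOp B u))) t ⬝ᵥ extend h u t := by
  have hz := isTrajectory_state h A B 0 u
  have hst : state h A B 0 u = stateOp h A (volterra h n (matrixOp B u)) := by
    have : (ContinuousMap.const _ 0 : Path s T n) = 0 := rfl
    rw [state, forcing, this, zero_add]
  -- Starting from zero, the state is also the perturbation produced by its own control, so the
  -- adjoint identity yields quadratic forms in `Qf` and `Q`.
  have key := integral_costate_dotProduct h A B Q Qf (state h A B 0 u)
    (continuous_extend h _).continuousOn hz
  have e : ∀ t, extend h (responseOp h B Q Qf A (volterra h n (matrixOp B u))) t ⬝ᵥ extend h u t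
      = extend h (costateOp h Q Qf A (state h A B 0 u)) t ⬝ᵥ (B *ᵥ extend h u t) := fun t => by
    rw [hst, Matrix.dotProduct_mulVec, ← Matrix.mulVec_transpose]
    rfl
  simp only [e]
  rw [key]
  refine add_nonneg ?_ (intervalIntegral.integral_nonneg h fun t _ => ?_)
  · rw [dotProduct_comm]; simpa using hQf.dotProduct_mulVec_nonneg (extend h (state h A B 0 u) T)
  · rw [dotProduct_comm]; simpa using hQ.dotProduct_mulVec_nonneg (extend h (state h A B 0 u) t)

end Feedback

/-! ### Real-valued costs of processes with square-integrable control -/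

/-- The cost as a real number; it is the cost when the control is square-integrable. -/
noncomputable def realCost {n m : ℕ} (Q Qf : Matrix (Fin n) (Fin n) ℝ)
    (R : Matrix (Fin m) (Fin m) ℝ) (s T : ℝ) (x : ℝ → Fin n → ℝ) (u : ℝ → Fin m → ℝ) : ℝ :=
  2⁻¹ * (∫ t in s..T, (x t ⬝ᵥ (Q *ᵥ x t) + u t ⬝ᵥ (R *ᵥ u t))) + 2⁻¹ * (x T ⬝ᵥ (Qf *ᵥ x T))

theorem quadratic_nonneg {k : ℕ} {Q : Matrix (Fin k) (Fin k) ℝ} (hQ : Q.PosSemidef)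
    (v : Fin k → ℝ) : 0 ≤ v ⬝ᵥ (Q *ᵥ v) := by
  simpa using hQ.dotProduct_mulVec_nonneg v

theorem quadratic_add {k : ℕ} {Q : Matrix (Fin k) (Fin k) ℝ} (hQ : Q.PosSemidef)
    (x z : Fin k → ℝ) :
    (x + z) ⬝ᵥ (Q *ᵥ (x + z)) = x ⬝ᵥ (Q *ᵥ x) + 2 * ((Q *ᵥ x) ⬝ᵥ z) + z ⬝ᵥ (Q *ᵥ z) := by
  have hQT : Qᵀ = Q := by simpa using hQ.isHermitian.eq
  have : x ⬝ᵥ (Q *ᵥ z) = (Q *ᵥ x) ⬝ᵥ z := by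
    rw [Matrix.dotProduct_mulVec, ← Matrix.mulVec_transpose, hQT]
  rw [Matrix.mulVec_add, add_dotProduct, dotProduct_add, dotProduct_add, this,
    dotProduct_comm z (Q *ᵥ x)]
  ring

section SquareIntegrable

variable {α : Type*} [MeasurableSpace α] {μ : Measure α} {k l : ℕ}

theorem integrable_dotProduct_of_memLp {a b : α → Fin k → ℝ} (ha : MemLp a 2 μ)
    (hb : MemLp b 2 μ) : Integrable (fun t => a t ⬝ᵥ b t) μ :=
  integrable_finsetSum _ fun i _ => (memLp_pi_iff.1 ha i).integrable_mul (memLp_pi_iff.1 hb i)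

theorem memLp_mulVec {a : α → Fin k → ℝ} (M : Matrix (Fin l) (Fin k) ℝ) (ha : MemLp a 2 μ) :
    MemLp (fun t => M *ᵥ a t) 2 μ :=
  (LinearMap.toContinuousLinearMap M.mulVecLin).comp_memLp' ha

end SquareIntegrable

section

variable {s T : ℝ} {n m : ℕ}

theorem memLp_of_continuousOn {k : ℕ} {x : ℝ → Fin k → ℝ} (hx : ContinuousOn x (Icc s T)) :
    MemLp x 2 (volume.restrict (Icc s T)) := by
  obtain ⟨C, hC⟩ := isCompact_Icc.exists_bound_of_continuousOn hx
  exact MemLp.of_bound (hx.aestronglyMeasurable measurableSet_Icc) C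
    ((ae_restrict_iff' measurableSet_Icc).2 (ae_of_all _ hC))

theorem intervalIntegrable_iff_integrable_Icc {E : Type*} [NormedAddCommGroup E] (h : s ≤ T)
    {f : ℝ → E} : IntervalIntegrable f volume s T ↔ Integrable f (volume.restrict (Icc s T)) :=
  intervalIntegrable_iff_integrableOn_Icc_of_le h

theorem integral_eq_integral_Icc (h : s ≤ T) (f : ℝ → ℝ) :
    ∫ t in s..T, f t = ∫ t in Icc s T, f t := by
  rw [intervalIntegral.integral_of_le h, integral_Icc_eq_integral_Ioc]

theorem intervalIntegrable_dotProduct_of_memLp (h : s ≤ T) {k : ℕ} {a b : ℝ → Fin k → ℝ}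
    (ha : MemLp a 2 (volume.restrict (Icc s T))) (hb : MemLp b 2 (volume.restrict (Icc s T))) :
    IntervalIntegrable (fun t => a t ⬝ᵥ b t) volume s T :=
  (intervalIntegrable_iff_integrable_Icc h).2 (integrable_dotProduct_of_memLp ha hb)

theorem IsTrajectory.continuousOn {A : Matrix (Fin n) (Fin n) ℝ} {B : Matrix (Fin n) (Fin m) ℝ}
    {x₀ : Fin n → ℝ} {u : ℝ → Fin m → ℝ} {x : ℝ → Fin n → ℝ} (h : s ≤ T)
    (hx : IsTrajectory A B s T x₀ u x) : ContinuousOn x (Icc s T) := by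
  have := intervalIntegral.continuousOn_primitive_interval' hx.1 left_mem_uIcc
  rw [uIcc_of_le h] at this
  exact (continuousOn_const.add this).congr hx.2

theorem IsTrajectory.sub {A : Matrix (Fin n) (Fin n) ℝ} {B : Matrix (Fin n) (Fin m) ℝ}
    {x₀ : Fin n → ℝ} {u v : ℝ → Fin m → ℝ} {x y : ℝ → Fin n → ℝ} (h : s ≤ T)
    (hy : IsTrajectory A B s T x₀ v y) (hx : IsTrajectory A B s T x₀ u x) :
    IsTrajectory A B s T 0 (v - u) (y - x) := by
  have e : (fun t => A *ᵥ (y - x) t + B *ᵥ (v - u) t) =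
      fun t => (A *ᵥ y t + B *ᵥ v t) - (A *ᵥ x t + B *ᵥ u t) := by
    funext t
    rw [Pi.sub_apply, Pi.sub_apply, Matrix.mulVec_sub, Matrix.mulVec_sub]
    abel
  refine ⟨by rw [e]; exact hy.1.sub hx.1, fun t ht => ?_⟩
  have hsub : uIcc s t ⊆ uIcc s T := by
    rw [uIcc_of_le h, uIcc_of_le ht.1]
    exact Icc_subset_Icc_right ht.2
  rw [e, intervalIntegral.integral_sub (hy.1.mono_set hsub) (hx.1.mono_set hsub), Pi.sub_apply,
    hy.2 t ht, hx.2 t ht]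
  abel

variable {Q Qf : Matrix (Fin n) (Fin n) ℝ} {R : Matrix (Fin m) (Fin m) ℝ}

theorem realCost_nonneg (h : s ≤ T) (hQ : Q.PosSemidef) (hQf : Qf.PosSemidef) (hR : R.PosSemidef)
    (x : ℝ → Fin n → ℝ) (u : ℝ → Fin m → ℝ) : 0 ≤ realCost Q Qf R s T x u := by
  have h1 : 0 ≤ ∫ t in s..T, (x t ⬝ᵥ (Q *ᵥ x t) + u t ⬝ᵥ (R *ᵥ u t)) :=
    intervalIntegral.integral_nonneg h fun t _ =>
      add_nonneg (quadratic_nonneg hQ _) (quadratic_nonneg hR _)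
  have h2 := quadratic_nonneg hQf (x T)
  unfold realCost
  positivity

theorem cost_eq_ofReal (h : s ≤ T) (hQ : Q.PosSemidef) (hQf : Qf.PosSemidef) (hR : R.PosSemidef)
    {x : ℝ → Fin n → ℝ} {u : ℝ → Fin m → ℝ} (hx : ContinuousOn x (Icc s T))
    (hu : MemLp u 2 (volume.restrict (Icc s T))) :
    cost Q Qf R s T x u = ENNReal.ofReal (realCost Q Qf R s T x u) := by
  have hx2 := memLp_of_continuousOn hx
  have h0 : ∀ t, 0 ≤ x t ⬝ᵥ (Q *ᵥ x t) + u t ⬝ᵥ (R *ᵥ u t) := fun t =>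
    add_nonneg (quadratic_nonneg hQ _) (quadratic_nonneg hR _)
  have hi := (integrable_dotProduct_of_memLp hx2 (memLp_mulVec Q hx2)).add
    (integrable_dotProduct_of_memLp hu (memLp_mulVec R hu))
  have h2 : ENNReal.ofReal 2⁻¹ = 2⁻¹ := by
    rw [ENNReal.ofReal_inv_of_pos two_pos, ENNReal.ofReal_ofNat]
  rw [cost, realCost, ENNReal.ofReal_add, ENNReal.ofReal_mul, ENNReal.ofReal_mul, h2,
    integral_eq_integral_Icc h]
  · congr 2
    exact (ofReal_integral_eq_lintegral_ofReal hi (ae_of_all _ h0)).symm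
  · norm_num
  · norm_num
  · exact mul_nonneg (by norm_num) (intervalIntegral.integral_nonneg h fun t _ => h0 t)
  · exact mul_nonneg (by norm_num) (quadratic_nonneg hQf _)

/-- Coercivity of `R` dominates `‖u‖²` by the running cost. Controls outside `L²` thus have infinite
cost and need no expansion. -/
theorem memLp_of_cost_ne_top (hQ : Q.PosSemidef) (hR : R.PosDef) {x : ℝ → Fin n → ℝ}
    {u : ℝ → Fin m → ℝ} (hu : IsControl s T u) (hcost : cost Q Qf R s T x u ≠ ∞) :
    MemLp u 2 (volume.restrict (Icc s T)) := by
  obtain ⟨r, hr, hRr⟩ := exists_coercive hR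
  have hum : AEStronglyMeasurable u (volume.restrict (Icc s T)) := hu.aestronglyMeasurable
  have hfin : ∫⁻ t in Icc s T, ENNReal.ofReal (x t ⬝ᵥ (Q *ᵥ x t) + u t ⬝ᵥ (R *ᵥ u t)) ≠ ∞ := by
    intro htop
    refine hcost ?_
    rw [cost, htop, ENNReal.mul_top (by simp), top_add]
  have hint : Integrable (fun t => r * ‖u t‖ ^ 2) (volume.restrict (Icc s T)) := by
    refine ⟨(hum.norm.pow 2).const_mul r, ?_⟩
    rw [hasFiniteIntegral_iff_ofReal (ae_of_all _ fun t => by positivity)]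
    refine lt_of_le_of_lt (lintegral_mono fun t => ENNReal.ofReal_le_ofReal ?_) hfin.lt_top
    linarith [hRr (u t), quadratic_nonneg hQ (x t)]
  rw [memLp_two_iff_integrable_sq_norm hum]
  have := hint.const_mul r⁻¹
  refine this.congr (ae_of_all _ fun t => ?_)
  field_simp

/-- The second-order expansion of the cost around a continuous control. -/
theorem realCost_expansion (h : s ≤ T) (hQ : Q.PosSemidef) (hQf : Qf.PosSemidef)
    (hR : R.PosSemidef) {A : Matrix (Fin n) (Fin n) ℝ} {B : Matrix (Fin n) (Fin m) ℝ}
    {x₀ : Fin n → ℝ} (u : Path s T m) {v : ℝ → Fin m → ℝ} {y : ℝ → Fin n → ℝ}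
    (hv : MemLp v 2 (volume.restrict (Icc s T))) (hy : IsTrajectory A B s T x₀ v y)
    (hw : IntervalIntegrable (v - extend h u) volume s T) :
    realCost Q Qf R s T y v = realCost Q Qf R s T (extend h (state h A B x₀ u)) (extend h u)
      + pairing h hw (matrixOp R u + responseOp h B Q Qf A (forcing h B x₀ u))
      + realCost Q Qf R s T (y - extend h (state h A B x₀ u)) (v - extend h u) := by
  set x := state h A B x₀ u
  have hx := isTrajectory_state h A B x₀ u
  have hz := hy.sub h hx
  have hzc := hz.continuousOn h
  set z := y - extend h x
  set w := v - extend h u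
  have hxc := (continuous_extend h x).continuousOn (s := Icc s T)
  have hx2 := memLp_of_continuousOn hxc
  have hu2 := memLp_of_continuousOn ((continuous_extend h u).continuousOn (s := Icc s T))
  have hz2 := memLp_of_continuousOn hzc
  have hw2 : MemLp w 2 (volume.restrict (Icc s T)) := hv.sub hu2
  have hyt : ∀ t, y t = extend h x t + z t := fun t => by simp [z]
  have hvt : ∀ t, v t = extend h u t + w t := fun t => by simp [w]
  have ixx := intervalIntegrable_dotProduct_of_memLp h hx2 (memLp_mulVec Q hx2)
  have iuu := intervalIntegrable_dotProduct_of_memLp h hu2 (memLp_mulVec R hu2)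
  have ixz := intervalIntegrable_dotProduct_of_memLp h (memLp_mulVec Q hx2) hz2
  have iuw := intervalIntegrable_dotProduct_of_memLp h (memLp_mulVec R hu2) hw2
  have izz := intervalIntegrable_dotProduct_of_memLp h hz2 (memLp_mulVec Q hz2)
  have iww := intervalIntegrable_dotProduct_of_memLp h hw2 (memLp_mulVec R hw2)
  -- The adjoint identity rewrites the first variation in the state as a pairing with the control
  -- perturbation alone.
  have hpair : pairing h hw (responseOp h B Q Qf A (forcing h B x₀ u)) =
      (Qf *ᵥ extend h x T) ⬝ᵥ z T + ∫ t in s..T, (Q *ᵥ extend h x t) ⬝ᵥ z t := by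
    rw [← integral_costate_dotProduct h A B Q Qf x hzc hz, pairing_apply]
    refine intervalIntegral.integral_congr fun t _ => ?_
    rw [Matrix.dotProduct_mulVec, ← Matrix.mulVec_transpose]
    rfl
  have hpairR : pairing h hw (matrixOp R u) = ∫ t in s..T, (R *ᵥ extend h u t) ⬝ᵥ w t := rfl
  have hint : ∫ t in s..T, (y t ⬝ᵥ (Q *ᵥ y t) + v t ⬝ᵥ (R *ᵥ v t)) =
      (∫ t in s..T, (extend h x t ⬝ᵥ (Q *ᵥ extend h x t) + extend h u t ⬝ᵥ (R *ᵥ extend h u t)))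
      + 2 * ((∫ t in s..T, (Q *ᵥ extend h x t) ⬝ᵥ z t) + ∫ t in s..T, (R *ᵥ extend h u t) ⬝ᵥ w t)
      + ∫ t in s..T, (z t ⬝ᵥ (Q *ᵥ z t) + w t ⬝ᵥ (R *ᵥ w t)) := by
    rw [← intervalIntegral.integral_add ixz iuw, ← intervalIntegral.integral_const_mul,
      ← intervalIntegral.integral_add (ixx.add iuu) ((ixz.add iuw).const_mul 2),
      ← intervalIntegral.integral_add ((ixx.add iuu).add ((ixz.add iuw).const_mul 2))
        (izz.add iww)]
    refine intervalIntegral.integral_congr fun t _ => ?_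
    rw [hyt, hvt, quadratic_add hQ, quadratic_add hR]
    ring
  rw [map_add, hpair, hpairR, realCost, hint, hyt T, quadratic_add hQf, realCost, realCost]
  ring

theorem half_integral_le_realCost (h : s ≤ T) (hQ : Q.PosSemidef) (hQf : Qf.PosSemidef)
    {z : ℝ → Fin n → ℝ} {w : ℝ → Fin m → ℝ} (hz : ContinuousOn z (Icc s T))
    (hw : MemLp w 2 (volume.restrict (Icc s T))) :
    2⁻¹ * ∫ t in s..T, w t ⬝ᵥ (R *ᵥ w t) ≤ realCost Q Qf R s T z w := by
  have hz2 := memLp_of_continuousOn hz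
  have h1 := intervalIntegral.integral_mono_on h
    (intervalIntegrable_dotProduct_of_memLp h hw (memLp_mulVec R hw))
    ((intervalIntegrable_dotProduct_of_memLp h hz2 (memLp_mulVec Q hz2)).add
      (intervalIntegrable_dotProduct_of_memLp h hw (memLp_mulVec R hw)))
    fun t _ => le_add_of_nonneg_left (quadratic_nonneg hQ (z t))
  have h2 := quadratic_nonneg hQf (z T)
  unfold realCost
  linarith

theorem ae_eq_of_integral_quadratic_nonpos (h : s ≤ T) (hR : R.PosDef) {u v : ℝ → Fin m → ℝ}
    (hw : MemLp (v - u) 2 (volume.restrict (Icc s T)))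
    (h0 : ∫ t in s..T, (v - u) t ⬝ᵥ (R *ᵥ (v - u) t) ≤ 0) :
    v =ᵐ[volume.restrict (Icc s T)] u := by
  obtain ⟨r, hr, hRr⟩ := exists_coercive hR
  have hnn : ∀ t, 0 ≤ (v - u) t ⬝ᵥ (R *ᵥ (v - u) t) := fun t =>
    quadratic_nonneg hR.posSemidef _
  rw [integral_eq_integral_Icc h] at h0
  have hi := integrable_dotProduct_of_memLp hw (memLp_mulVec R hw)
  have := (integral_eq_zero_iff_of_nonneg hnn hi).1 (le_antisymm h0 (integral_nonneg hnn))
  filter_upwards [this] with t ht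
  have h1 := hRr ((v - u) t)
  have h2 : (v - u) t ⬝ᵥ (R *ᵥ (v - u) t) = 0 := ht
  rw [h2] at h1
  have h3 : ‖(v - u) t‖ ^ 2 = 0 := le_antisymm (by nlinarith) (by positivity)
  exact sub_eq_zero.1 (norm_eq_zero.1 (pow_eq_zero_iff two_ne_zero |>.1 h3))

end

/-! ### The averaged problem -/

instance instSecondCountableTopologyMatrix {k l : ℕ} :
    SecondCountableTopology (Matrix (Fin k) (Fin l) ℝ) :=
  inferInstanceAs (SecondCountableTopology (Fin k → Fin l → ℝ))

section

variable {s T : ℝ} (h : s ≤ T) {n m : ℕ} {𝒜 : Set (Matrix (Fin n) (Fin n) ℝ)}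
  (B : Matrix (Fin n) (Fin m) ℝ) (Q Qf : Matrix (Fin n) (Fin n) ℝ) (R : Matrix (Fin m) (Fin m) ℝ)
  (x₀ : Fin n → ℝ)

theorem integrable_of_continuous [CompactSpace 𝒜] {F : Type*} [NormedAddCommGroup F]
    (π : ProbabilityMeasure 𝒜) {f : 𝒜 → F} (hf : Continuous f) :
    Integrable f (π : Measure 𝒜) :=
  hf.integrable_of_hasCompactSupport (HasCompactSupport.of_compactSpace f)

/-- The averaged response operator. -/
noncomputable def avgResponse (π : ProbabilityMeasure 𝒜) : Path s T n →L[ℝ] Path s T m :=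
  ∫ A : 𝒜, responseOp h B Q Qf (A : Matrix (Fin n) (Fin n) ℝ) ∂(π : Measure 𝒜)

/-- The solution `u` of `R u + Bᵀ 𝔼[p_A] = 0`. -/
noncomputable def optControl (π : ProbabilityMeasure 𝒜) : Path s T m :=
  -(Ring.inverse (feedbackOp h B R (avgResponse h B Q Qf π))
    (avgResponse h B Q Qf π (ContinuousMap.const _ x₀)))

theorem continuous_responseOp_coe :
    Continuous fun A : 𝒜 => responseOp h B Q Qf (A : Matrix (Fin n) (Fin n) ℝ) :=
  (continuous_responseOp h B Q Qf).comp continuous_subtype_val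

theorem continuous_responseOp_apply (y : Path s T n) :
    Continuous fun A : 𝒜 => responseOp h B Q Qf (A : Matrix (Fin n) (Fin n) ℝ) y :=
  (continuous_responseOp_coe h B Q Qf).clm_apply continuous_const

theorem avgResponse_apply [CompactSpace 𝒜] (π : ProbabilityMeasure 𝒜) (y : Path s T n) :
    avgResponse h B Q Qf π y =
      ∫ A : 𝒜, responseOp h B Q Qf (A : Matrix (Fin n) (Fin n) ℝ) y ∂(π : Measure 𝒜) :=
  ContinuousLinearMap.integral_apply
    (integrable_of_continuous π (continuous_responseOp_coe h B Q Qf)) y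

variable {Q Qf R}

/-- For fixed `u` the monotonicity integral is a continuous linear functional of the response, so it
commutes with averaging and stays nonnegative. -/
theorem isUnit_feedbackOp_avgResponse [CompactSpace 𝒜] (hQ : Q.PosSemidef) (hQf : Qf.PosSemidef)
    (hR : R.PosDef) (π : ProbabilityMeasure 𝒜) :
    IsUnit (feedbackOp h B R (avgResponse h B Q Qf π)) := by
  refine isUnit_feedbackOp h hR _ fun u => ?_
  rw [← pairing_apply h (intervalIntegrable_extend h u s T), avgResponse_apply,
    ← ContinuousLinearMap.integral_comp_comm _
      (integrable_of_continuous π (continuous_responseOp_apply h B Q Qf _))]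
  exact integral_nonneg fun A => integral_responseOp_nonneg h B hQ hQf A u

theorem optControl_stationary [CompactSpace 𝒜] (hQ : Q.PosSemidef) (hQf : Qf.PosSemidef)
    (hR : R.PosDef) (π : ProbabilityMeasure 𝒜) :
    matrixOp R (optControl h B Q Qf R x₀ π) +
      avgResponse h B Q Qf π (forcing h B x₀ (optControl h B Q Qf R x₀ π)) = 0 := by
  have := congr($(Ring.mul_inverse_cancel _ (isUnit_feedbackOp_avgResponse h B hQ hQf hR π))
    (-(avgResponse h B Q Qf π (ContinuousMap.const _ x₀))))
  have h2 : feedbackOp h B R (avgResponse h B Q Qf π) (optControl h B Q Qf R x₀ π) =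
      -(avgResponse h B Q Qf π (ContinuousMap.const _ x₀)) := by
    rw [optControl, ← map_neg]
    exact this
  rw [forcing, map_add, ← add_assoc, add_right_comm, ← eq_neg_iff_add_eq_zero]
  exact h2

theorem tendsto_optControl [CompactSpace 𝒜] (hQ : Q.PosSemidef) (hQf : Qf.PosSemidef)
    (hR : R.PosDef) {π : ℕ → ProbabilityMeasure 𝒜} {πinf : ProbabilityMeasure 𝒜}
    (hπ : Tendsto π atTop (𝓝 πinf)) :
    Tendsto (fun N => optControl h B Q Qf R x₀ (π N)) atTop
      (𝓝 (optControl h B Q Qf R x₀ πinf)) := by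
  -- Testing weak convergence against an operator-valued function gives convergence in operator
  -- norm, not just pointwise, so that inversion is continuous along the sequence.
  have hM : Tendsto (fun N => avgResponse h B Q Qf (π N)) atTop
      (𝓝 (avgResponse h B Q Qf πinf)) :=
    tendsto_integral_of_continuous hπ (continuous_responseOp_coe h B Q Qf)
  have hF : Tendsto (fun N => feedbackOp h B R (avgResponse h B Q Qf (π N))) atTop
      (𝓝 (feedbackOp h B R (avgResponse h B Q Qf πinf))) :=
    (((continuous_id.clm_comp continuous_const).tendsto _).comp hM).const_add _
  have hinv := (continuousAt_ringInverse (𝓡 := Path s T m →L[ℝ] Path s T m)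
    (isUnit_feedbackOp_avgResponse h B hQ hQf hR πinf)).tendsto.comp hF
  have hb := ((continuous_id.clm_apply
    (continuous_const (y := (ContinuousMap.const _ x₀ : Path s T n)))).tendsto _).comp hM
  exact (((continuous_fst.clm_apply continuous_snd).tendsto _).comp (hinv.prodMk_nhds hb)).neg

/-! ### Optimality and uniqueness by comparison of costs -/

theorem continuous_realCost {α : Type*} [TopologicalSpace α] [FirstCountableTopology α]
    {X : α → Path s T n} (hX : Continuous X) (u : Path s T m) :
    Continuous fun a => realCost Q Qf R s T (extend h (X a)) (extend h u) := by
  have hjoint : Continuous fun q : α × ℝ => extend h (X q.1) q.2 :=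
    (hX.comp continuous_fst).eval (continuous_projIcc.comp continuous_snd)
  have hu : Continuous fun q : α × ℝ => extend h u q.2 :=
    (continuous_extend h u).comp continuous_snd
  have hT : Continuous fun a => extend h (X a) T :=
    hjoint.comp (continuous_id.prodMk continuous_const)
  have hintegrand : Continuous (Function.uncurry fun (a : α) (t : ℝ) =>
      extend h (X a) t ⬝ᵥ (Q *ᵥ extend h (X a) t) + extend h u t ⬝ᵥ (R *ᵥ extend h u t)) :=
    (hjoint.dotProduct (continuous_const.matrix_mulVec hjoint)).add
      (hu.dotProduct (continuous_const.matrix_mulVec hu))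
  have hint := intervalIntegral.continuous_parametric_intervalIntegral_of_continuous' (μ := volume)
    hintegrand s T
  exact (hint.const_mul _).add ((hT.dotProduct (continuous_const.matrix_mulVec hT)).const_mul _)

theorem continuous_realCost_state (u : Path s T m) :
    Continuous fun A : 𝒜 =>
      realCost Q Qf R s T (extend h (state h (A : Matrix (Fin n) (Fin n) ℝ) B x₀ u))
        (extend h u) :=
  continuous_realCost h
    (((continuous_stateOp h).comp continuous_subtype_val).clm_apply continuous_const) u

/-- The second-order lower bound for the cost of a single system. -/
theorem ofReal_le_cost (hQ : Q.PosSemidef) (hQf : Qf.PosSemidef) (hR : R.PosSemidef)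
    {A : Matrix (Fin n) (Fin n) ℝ} (u : Path s T m) {v : ℝ → Fin m → ℝ} {y : ℝ → Fin n → ℝ}
    (hv : MemLp v 2 (volume.restrict (Icc s T))) (hy : IsTrajectory A B s T x₀ v y)
    (hw : IntervalIntegrable (v - extend h u) volume s T) :
    ENNReal.ofReal (realCost Q Qf R s T (extend h (state h A B x₀ u)) (extend h u)
      + pairing h hw (matrixOp R u + responseOp h B Q Qf A (forcing h B x₀ u))
      + 2⁻¹ * ∫ t in s..T, (v - extend h u) t ⬝ᵥ (R *ᵥ (v - extend h u) t)) ≤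
    cost Q Qf R s T y v := by
  have hu2 := memLp_of_continuousOn ((continuous_extend h u).continuousOn (s := Icc s T))
  rw [cost_eq_ofReal h hQ hQf hR (hy.continuousOn h) hv,
    realCost_expansion h hQ hQf hR u hv hy hw]
  refine ENNReal.ofReal_le_ofReal (add_le_add_right ?_ _)
  exact half_integral_le_realCost h hQ hQf
    ((hy.sub h (isTrajectory_state h A B x₀ u)).continuousOn h) (hv.sub hu2)

theorem intervalIntegrable_sub_extend (u : Path s T m) {v : ℝ → Fin m → ℝ}
    (hv : MemLp v 2 (volume.restrict (Icc s T))) :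
    IntervalIntegrable (v - extend h u) volume s T :=
  ((intervalIntegrable_iff_integrable_Icc h).2 (hv.integrable one_le_two)).sub
    (intervalIntegrable_extend h u s T)

theorem ofReal_integral_le_lintegral {α : Type*} [MeasurableSpace α] {μ : Measure α} {f : α → ℝ}
    (hf : Integrable f μ) : ENNReal.ofReal (∫ a, f a ∂μ) ≤ ∫⁻ a, ENNReal.ofReal (f a) ∂μ := by
  rw [integral_eq_lintegral_pos_part_sub_lintegral_neg_part hf]
  exact (ENNReal.ofReal_le_ofReal (sub_le_self _ ENNReal.toReal_nonneg)).trans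
    ENNReal.ofReal_toReal_le

theorem isControl_extend (u : Path s T m) : IsControl s T (extend h u) :=
  (continuous_extend h u).aemeasurable

/-- The states of all systems driven by a stationary control have a cost that is finite and smaller
than that of every admissible process, with a quadratic gap. -/
theorem avgCost_stationary_le [CompactSpace 𝒜] (hQ : Q.PosSemidef) (hQf : Qf.PosSemidef)
    (hR : R.PosDef) (π : ProbabilityMeasure 𝒜) {u : Path s T m}
    (hu : matrixOp R u + avgResponse h B Q Qf π (forcing h B x₀ u) = 0)
    {y : 𝒜 → ℝ → Fin n → ℝ} {v : ℝ → Fin m → ℝ} (hadm : IsAdmissibleAvg 𝒜 B s T x₀ y v) :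
    avgCost Q Qf R s T π (fun A => extend h (state h A B x₀ u)) (extend h u) ≤
        avgCost Q Qf R s T π y v ∧
      (avgCost Q Qf R s T π y v ≤
          avgCost Q Qf R s T π (fun A => extend h (state h A B x₀ u)) (extend h u) →
        v =ᵐ[volume.restrict (Icc s T)] extend h u) := by
  have hRs := hR.posSemidef
  have hu2 := memLp_of_continuousOn ((continuous_extend h u).continuousOn (s := Icc s T))
  set c : 𝒜 → ℝ := fun A => realCost Q Qf R s T (extend h (state h A B x₀ u)) (extend h u)
  have hc : Integrable c (π : Measure 𝒜) :=
    integrable_of_continuous π (continuous_realCost_state h B x₀ u)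
  have hc0 : ∀ A, 0 ≤ c A := fun A => realCost_nonneg h hQ hQf hRs _ _
  have hopt : avgCost Q Qf R s T π (fun A => extend h (state h A B x₀ u)) (extend h u) =
      ENNReal.ofReal (∫ A, c A ∂(π : Measure 𝒜)) := by
    rw [ofReal_integral_eq_lintegral_ofReal hc (ae_of_all _ hc0)]
    exact lintegral_congr fun A => cost_eq_ofReal h hQ hQf hRs
      (continuous_extend h _).continuousOn hu2
  by_cases hv : MemLp v 2 (volume.restrict (Icc s T))
  · have hw := intervalIntegrable_sub_extend h u hv
    set ρ := 2⁻¹ * ∫ t in s..T, (v - extend h u) t ⬝ᵥ (R *ᵥ (v - extend h u) t) with hρ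
    have hρ0 : 0 ≤ ρ := mul_nonneg (by norm_num)
      (intervalIntegral.integral_nonneg h fun t _ => quadratic_nonneg hRs _)
    have hresp := integrable_of_continuous π
      (continuous_responseOp_apply (𝒜 := 𝒜) h B Q Qf (forcing h B x₀ u))
    have hsum : Integrable (fun A : 𝒜 => matrixOp R u +
        responseOp h B Q Qf (A : Matrix (Fin n) (Fin n) ℝ) (forcing h B x₀ u))
        (π : Measure 𝒜) := (integrable_const _).add hresp
    have hℓ := (pairing h hw).integrable_comp hsum
    -- The linear term need not vanish for an individual `A`; only its average does, by
    -- stationarity.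
    have hℓ0 : ∫ A : 𝒜, pairing h hw (matrixOp R u + responseOp h B Q Qf
        (A : Matrix (Fin n) (Fin n) ℝ) (forcing h B x₀ u)) ∂(π : Measure 𝒜) = 0 := by
      rw [ContinuousLinearMap.integral_comp_comm _ hsum, integral_add (integrable_const _) hresp,
        ← avgResponse_apply]
      simp [hu]
    have hlow : ENNReal.ofReal (∫ A, c A ∂(π : Measure 𝒜) + ρ) ≤ avgCost Q Qf R s T π y v := by
      have hint : ∫ A : 𝒜, (c A + pairing h hw (matrixOp R u + responseOp h B Q Qf
          (A : Matrix (Fin n) (Fin n) ℝ) (forcing h B x₀ u)) + ρ) ∂(π : Measure 𝒜) =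
          ∫ A, c A ∂(π : Measure 𝒜) + ρ := by
        refine (integral_add (hc.add hℓ) (integrable_const ρ)).trans ?_
        exact congrArg₂ (· + ·) ((integral_add hc hℓ).trans (by rw [hℓ0, add_zero])) (by simp)
      rw [← hint]
      refine (ofReal_integral_le_lintegral ((hc.add hℓ).add (integrable_const _))).trans ?_
      -- Monotonicity of the lower integral needs no measurability of the cost of `y A` in `A`,
      -- about which nothing is known.
      exact lintegral_mono fun A => ofReal_le_cost h B x₀ hQ hQf hRs u hv (hadm.2 A) hw
    rw [hopt]
    refine ⟨(ENNReal.ofReal_le_ofReal (by linarith)).trans hlow, fun hle => ?_⟩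
    -- Equal costs squeeze the gap: the mean of `c` plus `ρ` is at most the mean of `c`, hence `ρ ≤
    -- 0`.
    have h1 := (ENNReal.ofReal_le_ofReal_iff (integral_nonneg hc0)).1 (hlow.trans hle)
    refine ae_eq_of_integral_quadratic_nonpos h hR (hv.sub hu2) ?_
    linarith
  · have htop : avgCost Q Qf R s T π y v = ∞ := by
      have : ∀ A, cost Q Qf R s T (y A) v = ∞ := fun A => by
        by_contra hne
        exact hv (memLp_of_cost_ne_top hQ hR hadm.1 hne)
      simp [avgCost, this]
    rw [htop, hopt]
    exact ⟨le_top, fun hle => absurd hle (by simp)⟩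

theorem isAdmissibleAvg_state (u : Path s T m) :
    IsAdmissibleAvg 𝒜 B s T x₀ (fun A => extend h (state h A B x₀ u)) (extend h u) :=
  ⟨isControl_extend h u, fun A => isTrajectory_state h A B x₀ u⟩

theorem isOptimalAvg_optControl [CompactSpace 𝒜] (hQ : Q.PosSemidef) (hQf : Qf.PosSemidef)
    (hR : R.PosDef) (π : ProbabilityMeasure 𝒜) :
    IsOptimalAvg B Q Qf R s T x₀ π (extend h (optControl h B Q Qf R x₀ π)) :=
  ⟨_, isAdmissibleAvg_state h B x₀ _, fun _ _ hadm => (avgCost_stationary_le h B x₀ hQ hQf hR π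
    (optControl_stationary h B x₀ hQ hQf hR π) hadm).1⟩

theorem IsOptimalAvg.ae_eq_optControl [CompactSpace 𝒜] (hQ : Q.PosSemidef)
    (hQf : Qf.PosSemidef) (hR : R.PosDef) (π : ProbabilityMeasure 𝒜) {u : ℝ → Fin m → ℝ}
    (hu : IsOptimalAvg B Q Qf R s T x₀ π u) :
    u =ᵐ[volume.restrict (Icc s T)] extend h (optControl h B Q Qf R x₀ π) := by
  obtain ⟨x, hadm, hle⟩ := hu
  exact (avgCost_stationary_le h B x₀ hQ hQf hR π
    (optControl_stationary h B x₀ hQ hQf hR π) hadm).2 (hle _ _ (isAdmissibleAvg_state h B x₀ _))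

/-! ### The problem with a known matrix -/

/-- The comparison is redone for one matrix because an LQR competitor carries a trajectory for that
matrix only, not for all of `𝒜`. -/
theorem cost_stationary_le (hQ : Q.PosSemidef) (hQf : Qf.PosSemidef) (hR : R.PosDef)
    {A : Matrix (Fin n) (Fin n) ℝ} {u : Path s T m}
    (hu : matrixOp R u + responseOp h B Q Qf A (forcing h B x₀ u) = 0)
    {y : ℝ → Fin n → ℝ} {v : ℝ → Fin m → ℝ} (hadm : IsAdmissibleLQR A B s T x₀ y v) :
    cost Q Qf R s T (extend h (state h A B x₀ u)) (extend h u) ≤ cost Q Qf R s T y v ∧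
      (cost Q Qf R s T y v ≤ cost Q Qf R s T (extend h (state h A B x₀ u)) (extend h u) →
        v =ᵐ[volume.restrict (Icc s T)] extend h u) := by
  have hRs := hR.posSemidef
  have hu2 := memLp_of_continuousOn ((continuous_extend h u).continuousOn (s := Icc s T))
  rw [cost_eq_ofReal h hQ hQf hRs (continuous_extend h _).continuousOn hu2]
  by_cases hv : MemLp v 2 (volume.restrict (Icc s T))
  · have hlow := ofReal_le_cost h B x₀ hQ hQf hRs u hv hadm.2 (intervalIntegrable_sub_extend h u hv)
    rw [hu, map_zero, add_zero] at hlow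
    have hq : 0 ≤ ∫ t in s..T, (v - extend h u) t ⬝ᵥ (R *ᵥ (v - extend h u) t) :=
      intervalIntegral.integral_nonneg h fun t _ => quadratic_nonneg hRs _
    refine ⟨(ENNReal.ofReal_le_ofReal (by linarith)).trans hlow, fun hle => ?_⟩
    have h1 := (ENNReal.ofReal_le_ofReal_iff (realCost_nonneg h hQ hQf hRs _ _)).1 (hlow.trans hle)
    refine ae_eq_of_integral_quadratic_nonpos h hR (hv.sub hu2) ?_
    linarith
  · have htop : cost Q Qf R s T y v = ∞ := by
      by_contra hne
      exact hv (memLp_of_cost_ne_top hQ hR hadm.1 hne)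
    rw [htop]
    exact ⟨le_top, fun hle => absurd hle (by simp)⟩

theorem avgResponse_dirac {π : ProbabilityMeasure 𝒜} {A : 𝒜}
    (hπ : (π : Measure 𝒜) = Measure.dirac A) : avgResponse h B Q Qf π = responseOp h B Q Qf A := by
  rw [avgResponse, hπ]
  exact integral_dirac _ _

theorem isOptimalLQR_optControl [CompactSpace 𝒜] (hQ : Q.PosSemidef) (hQf : Qf.PosSemidef)
    (hR : R.PosDef) {π : ProbabilityMeasure 𝒜} {A : 𝒜} (hπ : (π : Measure 𝒜) = Measure.dirac A) :
    IsOptimalLQR (A : Matrix (Fin n) (Fin n) ℝ) B Q Qf R s T x₀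
        (extend h (optControl h B Q Qf R x₀ π)) ∧
      ∀ u, IsOptimalLQR (A : Matrix (Fin n) (Fin n) ℝ) B Q Qf R s T x₀ u →
        u =ᵐ[volume.restrict (Icc s T)] extend h (optControl h B Q Qf R x₀ π) := by
  have hu := optControl_stationary h B x₀ hQ hQf hR π
  rw [avgResponse_dirac h B hπ] at hu
  have hadm : IsAdmissibleLQR (A : Matrix (Fin n) (Fin n) ℝ) B s T x₀ _ _ :=
    ⟨isControl_extend h (optControl h B Q Qf R x₀ π), isTrajectory_state h A B x₀ _⟩
  exact ⟨⟨_, hadm, fun y v hyv => (cost_stationary_le h B x₀ hQ hQf hR hu hyv).1⟩,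
    fun u ⟨x, hx, hle⟩ => (cost_stationary_le h B x₀ hQ hQf hR hu hx).2 (hle _ _ hadm)⟩

end

end AveragedLQ

/-! ### The main theorem -/

theorem theorem5p3 {n m : ℕ} (𝒜 : Set (Matrix (Fin n) (Fin n) ℝ)) (h𝒜 : IsCompact 𝒜)
    (B : Matrix (Fin n) (Fin m) ℝ) (Q Qf : Matrix (Fin n) (Fin n) ℝ)
    (R : Matrix (Fin m) (Fin m) ℝ)
    (hQ : Q.PosSemidef) (hQf : Qf.PosSemidef) (hR : R.PosDef)
    (T s : ℝ) (hs : s ∈ Icc 0 T) (x₀ : Fin n → ℝ)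
    (π : ℕ → ProbabilityMeasure 𝒜) (πinf : ProbabilityMeasure 𝒜)
    (hπ : Tendsto π atTop (𝓝 πinf)) :
    ∃ (ubar : ℕ → ℝ → Fin m → ℝ) (uinf : ℝ → Fin m → ℝ),
      -- `ubar N` is the unique optimal control for `π N` (in its continuous version)
      (∀ N, ContinuousOn (ubar N) (Icc s T) ∧
        AveragedLQ.IsOptimalAvg B Q Qf R s T x₀ (π N) (ubar N) ∧
        ∀ u, AveragedLQ.IsOptimalAvg B Q Qf R s T x₀ (π N) u →
          u =ᵐ[volume.restrict (Icc s T)] ubar N) ∧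
      -- `uinf` is the unique optimal control for `πinf` (in its continuous version)
      (ContinuousOn uinf (Icc s T) ∧
        AveragedLQ.IsOptimalAvg B Q Qf R s T x₀ πinf uinf ∧
        ∀ u, AveragedLQ.IsOptimalAvg B Q Qf R s T x₀ πinf u →
          u =ᵐ[volume.restrict (Icc s T)] uinf) ∧
      -- uniform convergence on `[s, T]`
      TendstoUniformlyOn ubar uinf atTop (Icc s T) ∧
      -- if `πinf` is a Dirac measure, the limit is the optimal control of the LQR problem
      (∀ Ahat : 𝒜, (πinf : Measure 𝒜) = Measure.dirac Ahat →
        AveragedLQ.IsOptimalLQR (Ahat : Matrix (Fin n) (Fin n) ℝ) B Q Qf R s T x₀ uinf ∧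
        ∀ u, AveragedLQ.IsOptimalLQR (Ahat : Matrix (Fin n) (Fin n) ℝ) B Q Qf R s T x₀ u →
          u =ᵐ[volume.restrict (Icc s T)] uinf) := by
  have h : s ≤ T := hs.2
  have : CompactSpace 𝒜 := isCompact_iff_compactSpace.1 h𝒜
  refine ⟨fun N => AveragedLQ.extend h (AveragedLQ.optControl h B Q Qf R x₀ (π N)),
    AveragedLQ.extend h (AveragedLQ.optControl h B Q Qf R x₀ πinf),
    fun N => ⟨(AveragedLQ.continuous_extend h _).continuousOn,
      AveragedLQ.isOptimalAvg_optControl h B x₀ hQ hQf hR (π N),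
      fun u hu => hu.ae_eq_optControl h B x₀ hQ hQf hR (π N)⟩,
    ⟨(AveragedLQ.continuous_extend h _).continuousOn,
      AveragedLQ.isOptimalAvg_optControl h B x₀ hQ hQf hR πinf,
      fun u hu => hu.ae_eq_optControl h B x₀ hQ hQf hR πinf⟩, ?_,
    fun Ahat hA => AveragedLQ.isOptimalLQR_optControl h B x₀ hQ hQf hR hA⟩
  -- Norm convergence of paths is uniform convergence on the subtype; composing with the projection
  -- carries it to the extended functions.
  have := ContinuousMap.tendsto_iff_tendstoUniformly.1
    (AveragedLQ.tendsto_optControl h B x₀ hQ hQf hR hπ)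
  exact (this.comp (projIcc s T h)).tendstoUniformlyOn
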